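/- Let $F_{1,2}=SU(3)/T^2$, with $T^2\subset SU(3)$ the diagonal torus, $\mathfrak t$ its Lie algebra, and $\mathfrak p\subset\mathfrak{su}(3)$ the space of matrices with zero diagonal, with basis $R_1=\begin{pmatrix}0&0&0\\0&0&-1\\0&1&0\end{pmatrix}$, $R_2=-i\begin{pmatrix}0&0&0\\0&0&1\\0&1&0\end{pmatrix}$, $R_3=\begin{pmatrix}0&0&1\\0&0&0\\-1&0&0\end{pmatrix}$, $R_4=-i\begin{pmatrix}0&0&1\\0&0&0\\1&0&0\end{pmatrix}$, $R_5=\begin{pmatrix}0&-1&0\\1&0&0\\0&0&0\end{pmatrix}$, $R_6=-i\begin{pmatrix}0&1&0\\1&0&0\\0&0&0\end{pmatrix}$. Fix $\nu>0$, let $E_i=\nu R_i$ with dual basis $e^i$, let $\bar g$ be the invariant metric for which $E_1,\dots,E_6$ is orthonormal, and let $V>0$ be the volume assigned to $\bar g$. Put $\alpha_1=(e^1)^2+(e^2)^2$, $\alpha_2=(e^3)^2+(e^4)^2$, $\alpha_3=(e^5)^2+(e^6)^2$. Spinors for an invariant metric $g$ are elements of $\Sigma_6=\mathbb C^2\otimes\mathbb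 C^2\otimes\mathbb C^2$, written in the frame $g^{-1/2}E_i$; an invariant spinor is an element of $\Sigma_6$ annihilated by the spin lift of the isotropy representation of $\mathfrak t$. The spinorial energy of an invariant metric $g$ and an invariant unit spinor $\varphi$ is $\mathcal E(g,\varphi)=\frac12\int|\nabla^g\varphi|^2\,\mathrm{vol}_g$. The homogeneous spinor flow is the negative $L^2$-gradient flow of $\mathcal E$ on pairs $(g,\varphi)$ of an invariant metric and an invariant unit spinor (metric variations being lifted horizontally for the Bourguignon–Gauduchon connection); the volume-normalized flow is the negative $L^2$-gradient flow of the restriction of $\mathcal E$ to pairs with $\mathrm{vol}(g)=V$. Then: 1. The invariant symmetric bilinear forms are exactly the real linear combinations of $\alpha_1,\alpha_2,\alpha_3$, and the invariant metrics are exactly $g=a_1\alpha_1+a_2\alpha_2+a_3\alpha_3$ with $a_i>0$. The volume of $g$ is $V a_1a_2a_3$. The frames $g^{-1/2}E_i$ are horizontal along invariant variations of $g$. 2. For every invariant metric the space of invariant spinors is the same $2$-dimensional space, spanned by the unit vectors $\varphi_1=\frac12(1,0,0,-1,0,-1,-1,0)$ and $\varphi_2=\frac12(0,1,1,0,1,0,0,-1)$,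 where $e_i\otimes e_j\otimes e_k$ is identified with $e_{1+i+2j+4k}$ ($i,j,k\in\{0,1\}$) and Clifford multiplication by the standard basis of $\mathbb R^6$ is given by $g_1\otimes T\otimes T$, $g_2\otimes T\otimes T$, $1\otimes g_1\otimes T$, $1\otimes g_2\otimes T$, $1\otimes1\otimes g_1$, $1\otimes1\otimes g_2$ with $T=\begin{pmatrix}0&-i\\i&0\end{pmatrix}$, $g_1=\begin{pmatrix}i&0\\0&-i\end{pmatrix}$, $g_2=\begin{pmatrix}0&i\\i&0\end{pmatrix}$. 3. For every invariant unit spinor $\varphi$, $$\mathcal E(g,\varphi)=4\nu^2V\Big(\tfrac3{16}(a_1^2+a_2^2+a_3^2)-\tfrac18(a_2a_3+a_1a_2+a_1a_3)\Big),$$ independently of $\varphi$. 4. Under both flows $\varphi$ is constant. On any interval, the homogeneous spinor flow is equivalent to the system, for $\{i,j,k\}=\{1,2,3\}$, $$\dot a_i=-4\nu^2\cdot\tfrac1{16}\,\frac{a_i}{a_ja_k}\,(3a_i-a_j-a_k),$$ and the volume-normalized flow is equivalent to the following system on $\{a_i>0,\ a_1a_2a_3=1\}$: $$\dot a_i=4\nu^2\cdot\tfrac1{48}\Big(-2-6\frac{a_i^2}{a_ja_k}+\frac{a_i(a_j+a_k)}{a_ja_k}+3\frac{a_j^2+a_k^2}{a_ja_k}\Big).$$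 The right-hand sides are the coefficients in $\alpha_1,\alpha_2,\alpha_3$ of the metric parts of the negative gradient and, at every invariant metric $g$, of the negative gradient of $\mathcal E$ restricted to the metrics with the same volume as $g$; the spinorial parts vanish. 5. $\mathcal E$ has no unconstrained critical points. A pair $(g,\varphi)$ with $\mathrm{vol}(g)=V$ is a critical point of $\mathcal E$ under the volume constraint if and only if $a_1=a_2=a_3$, i.e. $a_1=a_2=a_3=1$ and $g=\bar g$. This metric minimizes $\mathcal E$ among the invariant metrics of volume $V$. It is strictly nearly Kähler for an invariant almost complex structure, and it carries an invariant unit Killing spinor with non-zero real Killing constant. 6. The linearization at $(1,1,1)$ of the volume-normalized system in 4 (as a vector field on a neighbourhood in $\mathbb R^3$) is $\dot x=4\nu^2\cdot\frac1{48}\begin{pmatrix}-10&5&5\\5&-10&5\\5&5&-10\end{pmatrix}x$. Its eigenvalues are $0$, which is simple with eigenvector $(1,1,1)$, and $4\nu^2\cdot(-\frac5{16})$, by which it acts on the tangent space $\{x_1+x_2+x_3=0\}$ of the volume constraint. Moreover $\bar g$ is Lyapunov stable for the volume-normalized flow. 7. For every initial condition $(g_0,\varphi_0)$ with $\mathrm{vol}(g_0)=V$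 the volume-normalized flow has a solution on $[0,\infty)$, solutions are unique, and $g_t\to\bar g$ as $t\to\infty$. (For $V=1$ and $\nu=\frac12$ all constants $4\nu^2V$ and $4\nu^2$ equal $1$.) -/

import Mathlib

open Matrix Filter Topology
open scoped MatrixOrder Kronecker

noncomputable section

namespace FlagSpinorFlow

/-! ### The reductive decomposition `su(3) = t ⊕ p` -/

/-- The matrices `R₁, …, R₆`, a basis of the complement `p` of the diagonal torus algebra `t`
in `su(3)`. -/
def R : Fin 6 → Matrix (Fin 3) (Fin 3) ℂ := ![
  !![0, 0, 0; 0, 0, -1; 0, 1, 0],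
  (-Complex.I) • !![0, 0, 0; 0, 0, 1; 0, 1, 0],
  !![0, 0, 1; 0, 0, 0; -1, 0, 0],
  (-Complex.I) • !![0, 0, 1; 0, 0, 0; 1, 0, 0],
  !![0, -1, 0; 1, 0, 0; 0, 0, 0],
  (-Complex.I) • !![0, 1, 0; 1, 0, 0; 0, 0, 0]]

/-- The basis `E_i = ν R_i` of `p`, which is used to identify `p` with `ℝ⁶`. The background metric
`ḡ` is the one for which this basis is orthonormal. -/
def E (ν : ℝ) (i : Fin 6) : Matrix (Fin 3) (Fin 3) ℂ := (ν : ℂ) • R i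

/-- The coordinates, in the basis `E_i`, of the `p`-component of `X ∈ su(3) = t ⊕ p`. (The `R_i`
are orthonormal for `-½ Re tr(XY)`, and `t` is orthogonal to `p` for this inner product.) -/
def pCoord (ν : ℝ) (X : Matrix (Fin 3) (Fin 3) ℂ) : Fin 6 → ℝ :=
  fun i => -(1 / (2 * ν)) * (trace (R i * X)).re

/-- The element of `p` with coordinates `x`. -/
def pVec (ν : ℝ) (x : Fin 6 → ℝ) : Matrix (Fin 3) (Fin 3) ℂ := ∑ i, (x i : ℂ) • E ν i

/-- `[x, y]_p` in coordinates. -/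
def bracketP (ν : ℝ) (x y : Fin 6 → ℝ) : Fin 6 → ℝ :=
  pCoord ν (pVec ν x * pVec ν y - pVec ν y * pVec ν x)

/-- The maximal torus `T²` of diagonal matrices in `SU(3)`. -/
def torus : Set (Matrix (Fin 3) (Fin 3) ℂ) :=
  {t | t ∈ Matrix.specialUnitaryGroup (Fin 3) ℂ ∧ t.IsDiag}

/-- The Lie algebra `t` of `T²`: diagonal, trace-free, skew-Hermitian matrices. -/
def torusAlgebra : Set (Matrix (Fin 3) (Fin 3) ℂ) :=
  {X | X.IsDiag ∧ Xᴴ = -X ∧ X.trace = 0}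

/-- The isotropy representation `t ↦ Ad(t)|_p`, as a matrix in the basis `E_i`. -/
def isotropy (ν : ℝ) (t : Matrix (Fin 3) (Fin 3) ℂ) : Matrix (Fin 6) (Fin 6) ℝ :=
  Matrix.of fun i j => pCoord ν (t * E ν j * tᴴ) i

/-- The linearized isotropy representation `X ↦ ad(X)|_p`, as a matrix in the basis `E_i`. -/
def isotropyAlg (ν : ℝ) (X : Matrix (Fin 3) (Fin 3) ℂ) : Matrix (Fin 6) (Fin 6) ℝ :=
  Matrix.of fun i j => pCoord ν (X * E ν j - E ν j * X) i

/-! ### Invariant metrics -/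

/-- Invariant symmetric bilinear forms on `p`, as Gram matrices in the basis `E_i`. -/
def invariantForms (ν : ℝ) : Set (Matrix (Fin 6) (Fin 6) ℝ) :=
  {h | h.IsSymm ∧ ∀ t ∈ torus, (isotropy ν t)ᵀ * h * isotropy ν t = h}

/-- The space of `SU(3)`-invariant Riemannian metrics: positive definite invariant forms. -/
def invariantMetrics (ν : ℝ) : Set (Matrix (Fin 6) (Fin 6) ℝ) :=
  {g | g ∈ invariantForms ν ∧ g.PosDef}

/-- `a₁ α₁ + a₂ α₂ + a₃ α₃` with `α₁ = e₁² + e₂²`, `α₂ = e₃² + e₄²`, `α₃ = e₅² + e₆²`, where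
`e_i` is the basis dual to `E_i`. -/
def diagForm (a : Fin 3 → ℝ) : Matrix (Fin 6) (Fin 6) ℝ :=
  Matrix.diagonal ![a 0, a 0, a 1, a 1, a 2, a 2]

/-- The matrix `A = g^{-1/2}`, so that `g = A⁻ᵀ A⁻¹` and the vectors `Y_i = A E_i` form an
orthonormal frame of `g`. -/
def frame (g : Matrix (Fin 6) (Fin 6) ℝ) : Matrix (Fin 6) (Fin 6) ℝ := (CFC.sqrt g)⁻¹

/-- The `i`-th frame vector `Y_i = A E_i`, in coordinates. -/
def frameVec (g : Matrix (Fin 6) (Fin 6) ℝ) (i : Fin 6) : Fin 6 → ℝ := fun j => frame g j i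

/-- The volume of `F_{1,2}` for the metric `g`, if `V` is its volume for `ḡ`. -/
def volume (V : ℝ) (g : Matrix (Fin 6) (Fin 6) ℝ) : ℝ := V * (det (frame g))⁻¹

/-- `g([Y_i, Y_j]_p, Y_k)`: the `k`-th coordinate of `[Y_i, Y_j]_p` in the frame `Y`. -/
def structureConst (ν : ℝ) (g : Matrix (Fin 6) (Fin 6) ℝ) (i j k : Fin 6) : ℝ :=
  ((frame g)⁻¹ *ᵥ bracketP ν (frameVec g i) (frameVec g j)) k

/-- The Levi-Civita connection of the invariant metric `g` at the base point. The matrix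
`leviCivita ν g i` has the entries `g(Λ(Y_i) Y_k, Y_j)` in row `j` and column `k`, where
`Λ(X) Y = ½ [X, Y]_p + U(X, Y)` and
`2 g(U(X, Y), Z) = g([Z, X]_p, Y) + g(X, [Z, Y]_p)`. -/
def leviCivita (ν : ℝ) (g : Matrix (Fin 6) (Fin 6) ℝ) (i : Fin 6) : Matrix (Fin 6) (Fin 6) ℝ :=
  Matrix.of fun j k => (1 / 2) *
    (structureConst ν g i k j + structureConst ν g j i k + structureConst ν g j k i)

theorem bracketP_skew (ν : ℝ) (x y : Fin 6 → ℝ) : bracketP ν x y = -bracketP ν y x := by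
  funext i
  simp only [bracketP, pCoord, Pi.neg_apply, Matrix.mul_sub, Matrix.trace_sub, Complex.sub_re]
  ring

theorem structureConst_skew (ν : ℝ) (g : Matrix (Fin 6) (Fin 6) ℝ) (i j k : Fin 6) :
    structureConst ν g i j k = -structureConst ν g j i k := by
  simp only [structureConst]
  rw [bracketP_skew, Matrix.mulVec_neg, Pi.neg_apply]

/-- The connection is metric. -/
theorem leviCivita_metric (ν : ℝ) (g : Matrix (Fin 6) (Fin 6) ℝ) (i j k : Fin 6) :
    leviCivita ν g i j k = -leviCivita ν g i k j := by
  simp only [leviCivita, Matrix.of_apply]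
  rw [structureConst_skew ν g k i j, structureConst_skew ν g k j i,
    structureConst_skew ν g j i k]
  ring

/-- The connection is torsion-free: `Λ(Y_i) Y_k - Λ(Y_k) Y_i = [Y_i, Y_k]_p`. -/
theorem leviCivita_torsion (ν : ℝ) (g : Matrix (Fin 6) (Fin 6) ℝ) (i j k : Fin 6) :
    leviCivita ν g i j k - leviCivita ν g k j i = structureConst ν g i k j := by
  simp only [leviCivita, Matrix.of_apply]
  rw [structureConst_skew ν g k i j]
  ring

/-! ### Spinors -/

/-- Index set of the standard basis of `ℂ² ⊗ ℂ² ⊗ ℂ²`. -/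
abbrev SpinIdx : Type := Fin 2 × Fin 2 × Fin 2

/-- The spinor module `Σ₆ = ℂ² ⊗ ℂ² ⊗ ℂ²` with its standard Hermitian inner product. -/
abbrev Spinor : Type := EuclideanSpace ℂ SpinIdx

/-- The matrix `T` in the definition of the Clifford action. -/
def cT : Matrix (Fin 2) (Fin 2) ℂ := !![0, -Complex.I; Complex.I, 0]

/-- The matrix `g₁` in the definition of the Clifford action. -/
def cg1 : Matrix (Fin 2) (Fin 2) ℂ := !![Complex.I, 0; 0, -Complex.I]

/-- The matrix `g₂` in the definition of the Clifford action. -/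
def cg2 : Matrix (Fin 2) (Fin 2) ℂ := !![0, Complex.I; Complex.I, 0]

/-- Clifford multiplication by the standard basis vectors of `ℝ⁶`, with the convention
`e_i e_j + e_j e_i = -2 δ_{ij}`. -/
def clifford : Fin 6 → Matrix SpinIdx SpinIdx ℂ := ![
  cg1 ⊗ₖ (cT ⊗ₖ cT), cg2 ⊗ₖ (cT ⊗ₖ cT),
  1 ⊗ₖ (cg1 ⊗ₖ cT), 1 ⊗ₖ (cg2 ⊗ₖ cT),
  1 ⊗ₖ (1 ⊗ₖ cg1), 1 ⊗ₖ (1 ⊗ₖ cg2)]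

/-- The spin representation `so(6) ≅ spin(6) → End(Σ₆)`. The sign and factor are those for which
`[spinRep M, clifford v] = clifford (M v)` for skew-symmetric `M`. -/
def spinRep (M : Matrix (Fin 6) (Fin 6) ℝ) : Matrix SpinIdx SpinIdx ℂ :=
  ∑ j, ∑ k ∈ Finset.Ioi j, ((-(1 / 2) * M j k : ℝ) : ℂ) • (clifford j * clifford k)

/-- A matrix acting on spinors. -/
def act (M : Matrix SpinIdx SpinIdx ℂ) : Spinor →ₗ[ℂ] Spinor := Matrix.toEuclideanLin M

/-- The space `Σ₆ᵗ` of invariant spinors for the metric `g`: spinors, written in the spin frame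
that belongs to `A = g^{-1/2}`, that are killed by the spin lift of `A⁻¹ α_*(X) A`, `X ∈ t`. -/
def invariantSpinors (ν : ℝ) (g : Matrix (Fin 6) (Fin 6) ℝ) : Submodule ℂ Spinor :=
  ⨅ X ∈ torusAlgebra,
    LinearMap.ker (act (spinRep ((frame g)⁻¹ * isotropyAlg ν X * frame g)))

/-- `φ₁ = ½ (1, 0, 0, -1, 0, -1, -1, 0)`, with `e_i ⊗ e_j ⊗ e_k ↔ e_{1 + i + 2j + 4k}`. -/
def phi1 : Spinor := WithLp.toLp 2 fun p =>
  if p = (0, 0, 0) then 1 / 2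
  else if p = (1, 1, 0) ∨ p = (1, 0, 1) ∨ p = (0, 1, 1) then -(1 / 2) else 0

/-- `φ₂ = ½ (0, 1, 1, 0, 1, 0, 0, -1)`, with `e_i ⊗ e_j ⊗ e_k ↔ e_{1 + i + 2j + 4k}`. -/
def phi2 : Spinor := WithLp.toLp 2 fun p =>
  if p = (1, 1, 1) then -(1 / 2)
  else if p = (1, 0, 0) ∨ p = (0, 1, 0) ∨ p = (0, 0, 1) then 1 / 2 else 0

/-- The real inner product of spinors. -/
def reInner (φ ψ : Spinor) : ℝ := RCLike.re (inner ℂ φ ψ)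

/-- The spin covariant derivative `∇_{Y_i} φ` of the invariant spinor `φ` at the base point. -/
def covDeriv (ν : ℝ) (g : Matrix (Fin 6) (Fin 6) ℝ) (i : Fin 6) (φ : Spinor) : Spinor :=
  act (spinRep (leviCivita ν g i)) φ

/-- The spinorial energy `½ ∫ |∇φ|² vol_g`; the integrand is constant for invariant `(g, φ)`. -/
def energy (ν V : ℝ) (g : Matrix (Fin 6) (Fin 6) ℝ) (φ : Spinor) : ℝ :=
  (1 / 2) * ((∑ i, ‖covDeriv ν g i φ‖ ^ 2) * volume V g)

/-- The space `𝒩ᴳ` of pairs of an invariant metric and an invariant unit spinor. -/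
def unitSpinors (ν : ℝ) : Set (Matrix (Fin 6) (Fin 6) ℝ × Spinor) :=
  {p | p.1 ∈ invariantMetrics ν ∧ p.2 ∈ invariantSpinors ν p.1 ∧ ‖p.2‖ = 1}

/-- The subspace `𝒩₁ᴳ` of pairs whose metric has the volume of the background metric. -/
def unitSpinorsNormalized (ν V : ℝ) : Set (Matrix (Fin 6) (Fin 6) ℝ × Spinor) :=
  {p | p ∈ unitSpinors ν ∧ volume V p.1 = V}

/-! ### Gradients and flows -/

/-- The `L²` inner product `((h, k))_g` of invariant symmetric bilinear forms. -/
def l2Form (V : ℝ) (g h k : Matrix (Fin 6) (Fin 6) ℝ) : ℝ :=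
  volume V g * trace (h * g⁻¹ * k * g⁻¹)

/-- `Q = (Q₁, Q₂)` is the negative `L²`-gradient of the energy on `𝒩ᴳ` at `(g, φ)`. The metric is
varied with constant `φ`, i.e. `φ` is transported along with the frame `g^{-1/2}`. -/
structure IsNegGradient (ν V : ℝ) (g : Matrix (Fin 6) (Fin 6) ℝ) (φ : Spinor)
    (Q₁ : Matrix (Fin 6) (Fin 6) ℝ) (Q₂ : Spinor) : Prop where
  form_mem : Q₁ ∈ invariantForms ν
  spinor_mem : Q₂ ∈ invariantSpinors ν g
  spinor_orth : reInner φ Q₂ = 0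
  metric_deriv : ∀ k ∈ invariantForms ν,
    HasDerivAt (fun s : ℝ => energy ν V (g + s • k) φ) (-l2Form V g Q₁ k) 0
  spinor_deriv : ∀ ψ ∈ invariantSpinors ν g, reInner φ ψ = 0 →
    HasDerivAt (fun s : ℝ => energy ν V g (φ + s • ψ)) (-(volume V g * reInner Q₂ ψ)) 0

/-- `Q = (Q₁, Q₂)` is the negative `L²`-gradient at `(g, φ)` of the restriction of the energy to
pairs of fixed volume: the metric part is tangent to the constraint, i.e. `L²`-orthogonal to `g`,
and only such variations of the metric are tested. -/
structure IsNegGradientNormalized (ν V : ℝ) (g : Matrix (Fin 6) (Fin 6) ℝ) (φ : Spinor)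
    (Q₁ : Matrix (Fin 6) (Fin 6) ℝ) (Q₂ : Spinor) : Prop where
  form_mem : Q₁ ∈ invariantForms ν
  form_orth : l2Form V g Q₁ g = 0
  spinor_mem : Q₂ ∈ invariantSpinors ν g
  spinor_orth : reInner φ Q₂ = 0
  metric_deriv : ∀ k ∈ invariantForms ν, l2Form V g k g = 0 →
    HasDerivAt (fun s : ℝ => energy ν V (g + s • k) φ) (-l2Form V g Q₁ k) 0
  spinor_deriv : ∀ ψ ∈ invariantSpinors ν g, reInner φ ψ = 0 →
    HasDerivAt (fun s : ℝ => energy ν V g (φ + s • ψ)) (-(volume V g * reInner Q₂ ψ)) 0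

/-- `(g_t, φ_t)`, `t ∈ I`, solves the homogeneous spinor flow. -/
def IsFlow (ν V : ℝ) (I : Set ℝ) (g : ℝ → Matrix (Fin 6) (Fin 6) ℝ) (φ : ℝ → Spinor) : Prop :=
  ∀ t ∈ I, (g t, φ t) ∈ unitSpinors ν ∧ ∃ Q₁ Q₂, IsNegGradient ν V (g t) (φ t) Q₁ Q₂ ∧
    HasDerivWithinAt g Q₁ I t ∧ HasDerivWithinAt φ Q₂ I t

/-- `(g_t, φ_t)`, `t ∈ I`, solves the volume-normalized homogeneous spinor flow. -/
def IsFlowNormalized (ν V : ℝ) (I : Set ℝ) (g : ℝ → Matrix (Fin 6) (Fin 6) ℝ)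
    (φ : ℝ → Spinor) : Prop :=
  ∀ t ∈ I, (g t, φ t) ∈ unitSpinorsNormalized ν V ∧
    ∃ Q₁ Q₂, IsNegGradientNormalized ν V (g t) (φ t) Q₁ Q₂ ∧
      HasDerivWithinAt g Q₁ I t ∧ HasDerivWithinAt φ Q₂ I t

/-- The right-hand side of the flow equations for `(a₁, a₂, a₃)`; indices are cyclic. -/
def flowField (ν : ℝ) (a : Fin 3 → ℝ) : Fin 3 → ℝ := fun i =>
  4 * ν ^ 2 * (-(1 / 16) * (a i / (a (i + 1) * a (i + 2))) *
    (3 * a i - a (i + 1) - a (i + 2)))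

/-- The right-hand side of the volume-normalized flow equations; indices are cyclic. -/
def flowFieldNormalized (ν : ℝ) (a : Fin 3 → ℝ) : Fin 3 → ℝ := fun i =>
  4 * ν ^ 2 * ((1 / 48) * (-2 - 6 * (a i ^ 2 / (a (i + 1) * a (i + 2)))
    + a i * (a (i + 1) + a (i + 2)) / (a (i + 1) * a (i + 2))
    + 3 * ((a (i + 1) ^ 2 + a (i + 2) ^ 2) / (a (i + 1) * a (i + 2)))))

/-- The matrix of the linearized volume-normalized flow at `(1, 1, 1)`. -/
def linearization (ν : ℝ) : Matrix (Fin 3) (Fin 3) ℝ :=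
  (4 * ν ^ 2 * (1 / 48)) • !![-10, 5, 5; 5, -10, 5; 5, 5, -10]

/-! ### Nearly Kähler structures and Killing spinors -/

/-- The covariant derivative `∇_X J` of an invariant endomorphism field at the base point, where
`X = ∑ x_i Y_i` and `J` is a matrix in the frame `Y`. -/
def covDerivEnd (ν : ℝ) (g J : Matrix (Fin 6) (Fin 6) ℝ) (x : Fin 6 → ℝ) :
    Matrix (Fin 6) (Fin 6) ℝ :=
  (∑ i, x i • leviCivita ν g i) * J - J * ∑ i, x i • leviCivita ν g i

/-- The invariant metric `g` is strictly nearly Kähler, for an invariant orthogonal almost complex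
structure `J`: `(∇_X J) X = 0` for all `X`, and `∇_X J ≠ 0` for all `X ≠ 0`. -/
def IsStrictlyNearlyKahler (ν : ℝ) (g : Matrix (Fin 6) (Fin 6) ℝ) : Prop :=
  ∃ J : Matrix (Fin 6) (Fin 6) ℝ, J * J = -1 ∧ Jᵀ * J = 1 ∧
    (∀ t ∈ torus, J * ((frame g)⁻¹ * isotropy ν t * frame g)
      = (frame g)⁻¹ * isotropy ν t * frame g * J) ∧
    (∀ x, covDerivEnd ν g J x *ᵥ x = 0) ∧ ∀ x, x ≠ 0 → covDerivEnd ν g J x ≠ 0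

/-- `φ` is a Killing spinor: `∇_X φ = c X · φ` for all `X`. -/
def IsKillingSpinor (ν : ℝ) (g : Matrix (Fin 6) (Fin 6) ℝ) (c : ℝ) (φ : Spinor) : Prop :=
  ∀ i, covDeriv ν g i φ = (c : ℂ) • act (clifford i) φ

end FlagSpinorFlow

end

/-!
Everything is reduced by symmetry to computations with three positive numbers.

The torus acts on the three two-dimensional summands of `p` by pairwise inequivalent rotations, so
the invariant symmetric forms are the diagonal forms `diagForm v` (`mem_invariantForms_iff`), and
the frame of an invariant metric is a scalar on every summand. Hence the isotropy representation is
the same in all these frames, and so is the space of invariant spinors, spanned by `φ₁` and `φ₂`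
(`invariantSpinors_diagForm`).

In the basis `E_i` the `p`-part of the bracket has totally skew structure constants, and they vanish
unless the three indices belong to three different summands. By the Koszul formula the connection
matrix in the direction of `E_i` is therefore a fixed skew matrix times a scalar that depends on the
metric (`leviCivita_diagForm`). On the invariant spinors the spin lift of this fixed matrix is the
exchange of `φ₁` and `φ₂` followed by Clifford multiplication by `E_i` (`act_spinRep_bracketMat`),
so for unit spinors `|∇φ|²` depends only on the metric, and the energy is a quadratic polynomial in
`(a₁, a₂, a₃)` (`energy_diagForm`). At `a = (1, 1, 1)` the scalars coincide: the spinor `(φ₁ + φ₂) /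
√2` is Killing, and the almost complex structure that is `-i` on each summand is nearly Kähler since
the bracket is complex antilinear in both arguments.

The gradient is read off from the polynomial, and its spinorial part vanishes because the energy
depends on the spinor only through its norm. The normalized gradient is the projection of the
gradient orthogonally to the metric (`isNegGradient_iff`, `isNegGradientNormalized_iff`). Both flows
thereby become ordinary differential equations for `a` (`isFlow_iff`, `isFlowNormalized_iff`).

The sum `a₁ + a₂ + a₃` is a Lyapunov function of the normalized equations: by Schur's inequality its
derivative is at most a negative multiple of a weighted sum of squares of the differences
`a_i - a_j` (`sum_flowFieldNormalized_mul_le`). This determines the critical points. On the surface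
`a₁ a₂ a₃ = 1` the sum is at least `3`, with equality only at `(1, 1, 1)`; it bounds the parameters
from above and away from zero, and its difference from `3` is comparable with the sum of squares
(`sum_sub_three_le_spread`). The difference hence decays exponentially, which gives stability and
convergence. Solutions exist for all times since the largest parameter does not increase and the
smallest does not decrease: a cube is invariant, on which the field is Lipschitz and bounded
(`exists_solution_flowFieldNormalized`).
-/

noncomputable section

namespace FlagSpinorFlow

/-! ### The bracket of `p` in coordinates -/

/-- The index of the isotropy summand of `p` that contains `E_i`. -/
def block : Fin 6 → Fin 3 := ![0, 0, 1, 1, 2, 2]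

/-- The structure constants of `(X, Y) ↦ [X, Y]_p` in the basis `R_i`; they are integers and
totally skew-symmetric. -/
def bracketConst : Fin 6 → Fin 6 → Fin 6 → ℤ := ![
  ![![0, 0, 0, 0, 0, 0], ![0, 0, 0, 0, 0, 0], ![0, 0, 0, 0, 1, 0], ![0, 0, 0, 0, 0, -1],
    ![0, 0, -1, 0, 0, 0], ![0, 0, 0, 1, 0, 0]],
  ![![0, 0, 0, 0, 0, 0], ![0, 0, 0, 0, 0, 0], ![0, 0, 0, 0, 0, -1], ![0, 0, 0, 0, -1, 0],
    ![0, 0, 0, 1, 0, 0], ![0, 0, 1, 0, 0, 0]],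
  ![![0, 0, 0, 0, -1, 0], ![0, 0, 0, 0, 0, 1], ![0, 0, 0, 0, 0, 0], ![0, 0, 0, 0, 0, 0],
    ![1, 0, 0, 0, 0, 0], ![0, -1, 0, 0, 0, 0]],
  ![![0, 0, 0, 0, 0, 1], ![0, 0, 0, 0, 1, 0], ![0, 0, 0, 0, 0, 0], ![0, 0, 0, 0, 0, 0],
    ![0, -1, 0, 0, 0, 0], ![-1, 0, 0, 0, 0, 0]],
  ![![0, 0, 1, 0, 0, 0], ![0, 0, 0, -1, 0, 0], ![-1, 0, 0, 0, 0, 0], ![0, 1, 0, 0, 0, 0],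
    ![0, 0, 0, 0, 0, 0], ![0, 0, 0, 0, 0, 0]],
  ![![0, 0, 0, -1, 0, 0], ![0, 0, -1, 0, 0, 0], ![0, 1, 0, 0, 0, 0], ![1, 0, 0, 0, 0, 0],
    ![0, 0, 0, 0, 0, 0], ![0, 0, 0, 0, 0, 0]]]

lemma bracketConst_swap (i j k : Fin 6) : bracketConst i k j = -bracketConst i j k := by
  revert i j k; decide

lemma bracketConst_swap' (i j k : Fin 6) : bracketConst j i k = -bracketConst i j k := by
  revert i j k; decide

/-- The bracket of two isotropy summands of `p` has its `p`-part in the third one. -/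
lemma bracketConst_eq_zero_or (i j k : Fin 6) : bracketConst i j k = 0 ∨
    (block i = 0 ∧ block j = 1 ∧ block k = 2) ∨ (block i = 0 ∧ block j = 2 ∧ block k = 1) ∨
    (block i = 1 ∧ block j = 0 ∧ block k = 2) ∨ (block i = 1 ∧ block j = 2 ∧ block k = 0) ∨
    (block i = 2 ∧ block j = 0 ∧ block k = 1) ∨ (block i = 2 ∧ block j = 1 ∧ block k = 0) := by
  revert i j k; decide

lemma diagForm_eq (a : Fin 3 → ℝ) : diagForm a = diagonal fun i => a (block i) := by
  unfold diagForm block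
  congr 1
  funext i
  fin_cases i <;> rfl

lemma pVec_eq (ν : ℝ) (x : Fin 6 → ℝ) : pVec ν x = (ν : ℂ) • !![
    0, -(x 4 : ℂ) - Complex.I * x 5, x 2 - Complex.I * x 3;
    x 4 - Complex.I * x 5, 0, -(x 0 : ℂ) - Complex.I * x 1;
    -(x 2 : ℂ) - Complex.I * x 3, x 0 - Complex.I * x 1, 0] := by
  ext i j
  fin_cases i <;> fin_cases j <;>
    simp [pVec, E, R, Fin.sum_univ_succ, Matrix.add_apply] <;> ring

lemma pCoord_apply (ν : ℝ) (X : Matrix (Fin 3) (Fin 3) ℂ) : pCoord ν X =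
    (-(1 / (2 * ν))) • ![(X 1 2).re - (X 2 1).re, (X 1 2).im + (X 2 1).im,
      (X 2 0).re - (X 0 2).re, (X 2 0).im + (X 0 2).im,
      (X 0 1).re - (X 1 0).re, (X 0 1).im + (X 1 0).im] := by
  funext i
  fin_cases i <;>
    simp [pCoord, R, Matrix.trace, Fin.sum_univ_three, Matrix.vecMul, Matrix.cons_mul, vecHead,
      vecTail, -mul_eq_mul_left_iff] <;> ring

lemma bracketP_apply {ν : ℝ} (hν : ν ≠ 0) (x y : Fin 6 → ℝ) (k : Fin 6) :
    bracketP ν x y k = ν * ∑ i, ∑ j, x i * y j * bracketConst i j k := by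
  rw [bracketP, pCoord_apply, pVec_eq, pVec_eq]
  fin_cases k <;>
    simp [Fin.sum_univ_six, bracketConst] <;>
    field_simp <;> ring

/-! ### The Levi-Civita connection -/

lemma frame_diagonal {d : Fin 6 → ℝ} (hd : ∀ i, 0 < d i) :
    frame (diagonal d) = diagonal fun i => (√(d i))⁻¹ := by
  have hs : CFC.sqrt (diagonal d) = diagonal fun i => √(d i) := by
    refine CFC.sqrt_unique ?_ ?_
    · rw [diagonal_mul_diagonal]
      congr 1
      funext i
      exact Real.mul_self_sqrt (hd i).le
    · rw [Matrix.nonneg_iff_posSemidef]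
      exact PosSemidef.diagonal fun i => Real.sqrt_nonneg _
  rw [frame, hs]
  refine Matrix.inv_eq_right_inv ?_
  rw [diagonal_mul_diagonal, ← diagonal_one]
  congr 1
  funext i
  exact mul_inv_cancel₀ (Real.sqrt_pos.2 (hd i)).ne'

lemma frame_diagonal_inv {d : Fin 6 → ℝ} (hd : ∀ i, 0 < d i) :
    (frame (diagonal d))⁻¹ = diagonal fun i => √(d i) := by
  rw [frame_diagonal hd]
  refine Matrix.inv_eq_right_inv ?_
  rw [diagonal_mul_diagonal, ← diagonal_one]
  congr 1
  funext i
  exact inv_mul_cancel₀ (Real.sqrt_pos.2 (hd i)).ne'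

lemma structureConst_diagonal {ν : ℝ} (hν : ν ≠ 0) {d : Fin 6 → ℝ} (hd : ∀ i, 0 < d i)
    (i j k : Fin 6) : structureConst ν (diagonal d) i j k =
      ν * (√(d k) / (√(d i) * √(d j))) * bracketConst i j k := by
  rw [structureConst, frame_diagonal_inv hd, mulVec_diagonal, bracketP_apply hν,
    Finset.sum_eq_single i, Finset.sum_eq_single j]
  · simp only [frameVec, frame_diagonal hd, diagonal_apply_eq]
    rw [div_eq_mul_inv, mul_inv]
    ring
  · intro b _ hb
    simp [frameVec, frame_diagonal hd, diagonal_apply_ne _ hb]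
  · simp
  · intro b _ hb
    simp [frameVec, frame_diagonal hd, diagonal_apply_ne _ hb]
  · simp

/-- The skew-symmetric matrix of the structure constants with first index `i`. -/
def bracketMat (i : Fin 6) : Matrix (Fin 6) (Fin 6) ℝ :=
  Matrix.of fun j k => (bracketConst i j k : ℝ)

/-- The factor by which the Levi-Civita connection of `diagForm a` differs from `bracketMat` on
the isotropy summand with index `c`. -/
def connFactor (ν : ℝ) (a : Fin 3 → ℝ) (c : Fin 3) : ℝ :=
  ν * (2 * a c - (a 0 + a 1 + a 2)) / (2 * (√(a 0) * √(a 1) * √(a 2)))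

/-- Because the bracket constants are totally skew and couple only the three different summands,
each of the matrices of the Levi-Civita connection is a multiple of a fixed one. -/
lemma leviCivita_diagForm {ν : ℝ} (hν : ν ≠ 0) {a : Fin 3 → ℝ} (ha : ∀ i, 0 < a i) (i : Fin 6) :
    leviCivita ν (diagForm a) i = connFactor ν a (block i) • bracketMat i := by
  have hd : ∀ i, 0 < a (block i) := fun i => ha _
  ext j k
  simp only [leviCivita, of_apply, diagForm_eq, structureConst_diagonal hν hd, Matrix.smul_apply,
    bracketMat, smul_eq_mul]
  rw [bracketConst_swap j i k, bracketConst_swap i j k, bracketConst_swap' i j k, connFactor]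
  have key : ∀ x y z : ℝ, 0 < x → 0 < y → 0 < z →
      1 / 2 * (ν * (√y / (√x * √z)) * (-bracketConst i j k : ℝ)
        + ν * (√z / (√y * √x)) * (-bracketConst i j k : ℝ)
        + ν * (√x / (√y * √z)) * (bracketConst i j k : ℝ))
      = ν * (x - y - z) / (2 * (√x * √y * √z)) * bracketConst i j k := by
    intro x y z hx hy hz
    have hx' := Real.sqrt_pos.2 hx
    have hy' := Real.sqrt_pos.2 hy
    have hz' := Real.sqrt_pos.2 hz
    field_simp
    rw [Real.sq_sqrt hx.le, Real.sq_sqrt hy.le, Real.sq_sqrt hz.le]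
    ring
  have key' := key _ _ _ (hd i) (hd j) (hd k)
  push_cast at key' ⊢
  rw [neg_neg, key']
  rcases bracketConst_eq_zero_or i j k with h | h | h | h | h | h | h
  · simp [h]
  all_goals
    obtain ⟨h1, h2, h3⟩ := h
    rw [h1, h2, h3]
    congr 1
    congr 1 <;> ring

/-! ### The isotropy representation -/

/-- The endomorphism of `p` that multiplies the three isotropy summands, viewed as complex lines
with coordinates `x₁ - i x₂`, `x₃ - i x₄`, `x₅ - i x₆`, by the complex numbers `u 0, u 1, u 2`. -/
def blockMul (u : Fin 3 → ℂ) : Matrix (Fin 6) (Fin 6) ℝ := !![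
  (u 0).re, (u 0).im, 0, 0, 0, 0;
  -(u 0).im, (u 0).re, 0, 0, 0, 0;
  0, 0, (u 1).re, (u 1).im, 0, 0;
  0, 0, -(u 1).im, (u 1).re, 0, 0;
  0, 0, 0, 0, (u 2).re, (u 2).im;
  0, 0, 0, 0, -(u 2).im, (u 2).re]

lemma blockMul_mul (u v : Fin 3 → ℂ) : blockMul u * blockMul v = blockMul (u * v) := by
  ext i j
  fin_cases i <;> fin_cases j <;>
    simp [blockMul, Matrix.mul_apply, Fin.sum_univ_six] <;> ring

lemma blockMul_comm (u v : Fin 3 → ℂ) : blockMul u * blockMul v = blockMul v * blockMul u := by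
  rw [blockMul_mul, blockMul_mul, mul_comm]

lemma blockMul_transpose (u : Fin 3 → ℂ) : (blockMul u)ᵀ = blockMul (star u) := by
  ext i j
  fin_cases i <;> fin_cases j <;> simp [blockMul]

lemma diagonal_block (v : Fin 3 → ℝ) :
    diagonal (fun i => v (block i)) = blockMul fun c => (v c : ℂ) := by
  ext i j
  fin_cases i <;> fin_cases j <;> simp [blockMul, block]

lemma diagForm_eq_blockMul (v : Fin 3 → ℝ) : diagForm v = blockMul fun c => (v c : ℂ) := by
  rw [diagForm_eq, diagonal_block]

lemma isotropy_diagonal {ν : ℝ} (hν : ν ≠ 0) (d : Fin 3 → ℂ) :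
    isotropy ν (diagonal d) =
      blockMul ![d 2 * star (d 1), d 0 * star (d 2), d 1 * star (d 0)] := by
  ext i j
  rw [isotropy, of_apply, pCoord_apply]
  simp only [diagonal_conjTranspose, mul_diagonal, diagonal_mul]
  fin_cases i <;> fin_cases j <;> simp [blockMul, E, R] <;> field_simp <;> ring

lemma isotropyAlg_diagonal {ν : ℝ} (hν : ν ≠ 0) {d : Fin 3 → ℂ} (hd : ∀ i, (d i).re = 0) :
    isotropyAlg ν (diagonal d) = blockMul ![d 2 - d 1, d 0 - d 2, d 1 - d 0] := by
  ext i j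
  rw [isotropyAlg, of_apply, pCoord_apply]
  simp only [Matrix.sub_apply, mul_diagonal, diagonal_mul]
  fin_cases i <;> fin_cases j <;> simp [blockMul, E, R, hd] <;> field_simp <;> ring

lemma mem_torus_iff {t : Matrix (Fin 3) (Fin 3) ℂ} : t ∈ torus ↔
    ∃ d : Fin 3 → ℂ, t = diagonal d ∧ (∀ i, d i * star (d i) = 1) ∧ d 0 * d 1 * d 2 = 1 := by
  constructor
  · rintro ⟨ht, hdiag⟩
    rw [mem_specialUnitaryGroup_iff, mem_unitaryGroup_iff] at ht
    obtain ⟨d, rfl⟩ : ∃ d, t = diagonal d := ⟨t.diag, hdiag.diagonal_diag.symm⟩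
    refine ⟨d, rfl, fun i => ?_, ?_⟩
    · have := congrFun₂ ht.1 i i
      simpa [star_eq_conjTranspose, diagonal_conjTranspose] using this
    · simpa [det_diagonal, Fin.prod_univ_three] using ht.2
  · rintro ⟨d, rfl, h1, h2⟩
    refine ⟨?_, isDiag_diagonal d⟩
    rw [mem_specialUnitaryGroup_iff, mem_unitaryGroup_iff]
    refine ⟨?_, by simpa [det_diagonal, Fin.prod_univ_three] using h2⟩
    rw [star_eq_conjTranspose, diagonal_conjTranspose, diagonal_mul_diagonal, ← diagonal_one]
    congr 1
    funext i
    exact h1 i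

/-! ### Invariant forms and metrics -/

lemma diagForm_mem_invariantForms {ν : ℝ} (hν : ν ≠ 0) (v : Fin 3 → ℝ) :
    diagForm v ∈ invariantForms ν := by
  refine ⟨isSymm_diagonal _, fun t ht => ?_⟩
  obtain ⟨d, rfl, h1, -⟩ := mem_torus_iff.1 ht
  have h : ∀ i j, starRingEnd ℂ (d i * star (d j)) * (d i * star (d j)) = 1 := by
    intro i j
    have e : starRingEnd ℂ (d i * star (d j)) * (d i * star (d j)) =
        (d i * star (d i)) * (d j * star (d j)) := by
      simp
      ring
    rw [e, h1, h1, one_mul]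
  rw [isotropy_diagonal hν, diagForm_eq_blockMul, blockMul_transpose, blockMul_mul, blockMul_mul,
    mul_right_comm]
  congr 1
  funext c
  simp only [Pi.mul_apply, Pi.star_apply]
  fin_cases c
  · exact (congrArg (· * (v 0 : ℂ)) (h 2 1)).trans (one_mul _)
  · exact (congrArg (· * (v 1 : ℂ)) (h 0 2)).trans (one_mul _)
  · exact (congrArg (· * (v 2 : ℂ)) (h 1 0)).trans (one_mul _)

/-- Four elements of the torus suffice to force an invariant form to be diagonal: two of them act
by different signs on the three summands, the other two by a quarter turn on some summand. -/
lemma mem_invariantForms_iff {ν : ℝ} (hν : ν ≠ 0) (h : Matrix (Fin 6) (Fin 6) ℝ) :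
    h ∈ invariantForms ν ↔ ∃ v : Fin 3 → ℝ, h = diagForm v := by
  constructor
  · rintro ⟨hs, hinv⟩
    have key : ∀ d : Fin 3 → ℂ, (∀ i, d i * star (d i) = 1) → d 0 * d 1 * d 2 = 1 → ∀ i j,
        ((blockMul ![d 2 * star (d 1), d 0 * star (d 2), d 1 * star (d 0)])ᵀ * h *
          blockMul ![d 2 * star (d 1), d 0 * star (d 2), d 1 * star (d 0)]) i j = h i j := by
      intro d h1 h2 i j
      rw [← isotropy_diagonal hν, hinv _ (mem_torus_iff.2 ⟨d, rfl, h1, h2⟩)]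
    have k1 := key ![-1, 1, -1] (by intro i; fin_cases i <;> simp) (by simp)
    have k2 := key ![1, -1, -1] (by intro i; fin_cases i <;> simp) (by simp)
    have k3 := key ![1, Complex.I, -Complex.I] (by intro i; fin_cases i <;> simp) (by simp)
    have k4 := key ![Complex.I, -Complex.I, 1] (by intro i; fin_cases i <;> simp) (by simp)
    simp only [blockMul_transpose] at k1 k2 k3 k4
    have s : ∀ i j, h j i = h i j := fun i j => congrFun₂ hs i j
    have z02 := k1 0 2
    have z03 := k1 0 3
    have z12 := k1 1 2
    have z13 := k1 1 3
    have z24 := k1 2 4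
    have z25 := k1 2 5
    have z34 := k1 3 4
    have z35 := k1 3 5
    have z04 := k2 0 4
    have z05 := k2 0 5
    have z14 := k2 1 4
    have z15 := k2 1 5
    have z23 := k3 2 3
    have z22 := k3 2 2
    have z45 := k3 4 5
    have z44 := k3 4 4
    have z01 := k4 0 1
    have z00 := k4 0 0
    simp [blockMul, Matrix.mul_apply, Matrix.vecMul, dotProduct, Fin.sum_univ_six] at z02 z03 z12 z13
    simp [blockMul, Matrix.mul_apply, Matrix.vecMul, dotProduct, Fin.sum_univ_six] at z24 z25 z34 z35
    simp [blockMul, Matrix.mul_apply, Matrix.vecMul, dotProduct, Fin.sum_univ_six] at z04 z05 z14 z15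
    simp [blockMul, Matrix.mul_apply, Matrix.vecMul, dotProduct, Fin.sum_univ_six] at z23 z22 z45 z44
    simp [blockMul, Matrix.mul_apply, Matrix.vecMul, dotProduct, Fin.sum_univ_six] at z01 z00
    refine ⟨![h 0 0, h 2 2, h 4 4], ?_⟩
    ext i j
    fin_cases i <;> fin_cases j <;> simp [diagForm] <;>
      linarith [s 0 1, s 0 2, s 0 3, s 0 4, s 0 5, s 1 2, s 1 3, s 1 4, s 1 5, s 2 3, s 2 4, s 2 5,
        s 3 4, s 3 5, s 4 5]
  · rintro ⟨v, rfl⟩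
    exact diagForm_mem_invariantForms hν v

lemma diagForm_injective : Function.Injective diagForm := by
  intro a b hab
  funext c
  have h0 := congrFun₂ hab 0 0
  have h2 := congrFun₂ hab 2 2
  have h4 := congrFun₂ hab 4 4
  fin_cases c
  · simpa [diagForm] using h0
  · simpa [diagForm] using h2
  · simpa [diagForm] using h4

lemma diagForm_posDef_iff {a : Fin 3 → ℝ} : (diagForm a).PosDef ↔ ∀ i, 0 < a i := by
  rw [diagForm_eq, posDef_diagonal_iff]
  refine ⟨fun h i => ?_, fun h i => h _⟩
  fin_cases i
  exacts [h 0, h 2, h 4]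

lemma diagForm_mem_invariantMetrics {ν : ℝ} (hν : ν ≠ 0) {a : Fin 3 → ℝ} :
    diagForm a ∈ invariantMetrics ν ↔ ∀ i, 0 < a i :=
  ⟨fun h => diagForm_posDef_iff.1 h.2,
    fun h => ⟨diagForm_mem_invariantForms hν a, diagForm_posDef_iff.2 h⟩⟩

lemma mem_invariantMetrics_iff {ν : ℝ} (hν : ν ≠ 0) (g : Matrix (Fin 6) (Fin 6) ℝ) :
    g ∈ invariantMetrics ν ↔ ∃ a : Fin 3 → ℝ, (∀ i, 0 < a i) ∧ g = diagForm a := by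
  constructor
  · intro hg
    obtain ⟨a, rfl⟩ := (mem_invariantForms_iff hν g).1 hg.1
    exact ⟨a, diagForm_posDef_iff.1 hg.2, rfl⟩
  · rintro ⟨a, ha, rfl⟩
    exact (diagForm_mem_invariantMetrics hν).2 ha

lemma frame_diagForm {a : Fin 3 → ℝ} (ha : ∀ i, 0 < a i) :
    frame (diagForm a) = diagForm fun c => (√(a c))⁻¹ := by
  rw [diagForm_eq, diagForm_eq, frame_diagonal fun i => ha _]

lemma frame_diagForm_inv {a : Fin 3 → ℝ} (ha : ∀ i, 0 < a i) :
    (frame (diagForm a))⁻¹ = diagForm fun c => √(a c) := by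
  rw [diagForm_eq, diagForm_eq, frame_diagonal_inv fun i => ha _]

/-- The frame is a multiple of the identity on each summand, so that conjugation with it does not
change the isotropy representation. -/
lemma frame_inv_mul_blockMul_mul_frame {a : Fin 3 → ℝ} (ha : ∀ i, 0 < a i) (u : Fin 3 → ℂ) :
    (frame (diagForm a))⁻¹ * blockMul u * frame (diagForm a) = blockMul u := by
  rw [frame_diagForm_inv ha, frame_diagForm ha, diagForm_eq_blockMul, diagForm_eq_blockMul,
    blockMul_mul, blockMul_mul]
  congr 1
  funext c
  have h : (√(a c) : ℂ) ≠ 0 := Complex.ofReal_ne_zero.2 (Real.sqrt_pos.2 (ha c)).ne'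
  simp only [Pi.mul_apply, Complex.ofReal_inv]
  field_simp

lemma volume_diagForm (V : ℝ) {a : Fin 3 → ℝ} (ha : ∀ i, 0 < a i) :
    volume V (diagForm a) = V * (a 0 * a 1 * a 2) := by
  rw [volume, ← Ring.inverse_eq_inv', ← det_nonsing_inv, frame_diagForm_inv ha, diagForm,
    det_diagonal, Fin.prod_univ_six]
  simp only [cons_val]
  have h : ∀ i, √(a i) * √(a i) = a i := fun i => Real.mul_self_sqrt (ha i).le
  calc _ = V * ((√(a 0) * √(a 0)) * (√(a 1) * √(a 1)) * (√(a 2) * √(a 2))) := by ring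
    _ = _ := by rw [h, h, h]

/-! ### Variations of the metric -/

lemma diagForm_add_smul (a v : Fin 3 → ℝ) (s : ℝ) :
    diagForm a + s • diagForm v = diagForm (a + s • v) := by
  simp only [diagForm_eq, ← diagonal_smul, diagonal_add]
  rfl

lemma eventually_add_smul_pos {a : Fin 3 → ℝ} (ha : ∀ i, 0 < a i) (v : Fin 3 → ℝ) :
    ∀ᶠ s : ℝ in 𝓝 0, ∀ i, 0 < (a + s • v) i := by
  rw [Filter.eventually_all]
  intro i
  have hc : ContinuousAt (fun s : ℝ => (a + s • v) i) 0 := by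
    simp only [Pi.add_apply, Pi.smul_apply, smul_eq_mul]
    fun_prop
  exact hc.eventually_const_lt (by simpa using ha i)

lemma hasDerivWithinAt_matrix_iff {F : ℝ → Matrix (Fin 6) (Fin 6) ℝ}
    {M : Matrix (Fin 6) (Fin 6) ℝ} {s : Set ℝ} {t : ℝ} :
    HasDerivWithinAt F M s t ↔ ∀ i j, HasDerivWithinAt (fun r => F r i j) (M i j) s t := by
  have h : HasDerivWithinAt (fun r i => F r i) (fun i => M i) s t ↔ _ := hasDerivWithinAt_pi
  exact h.trans (forall_congr' fun i => hasDerivWithinAt_pi)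

lemma hasDerivAt_matrix_iff {F : ℝ → Matrix (Fin 6) (Fin 6) ℝ}
    {M : Matrix (Fin 6) (Fin 6) ℝ} {t : ℝ} :
    HasDerivAt F M t ↔ ∀ i j, HasDerivAt (fun r => F r i j) (M i j) t := by
  have h : HasDerivAt (fun r i => F r i) (fun i => M i) t ↔ _ := hasDerivAt_pi
  exact h.trans (forall_congr' fun i => hasDerivAt_pi)

lemma frame_horizontal {ν : ℝ} (hν : ν ≠ 0) {g k : Matrix (Fin 6) (Fin 6) ℝ}
    (hg : g ∈ invariantMetrics ν) (hk : k ∈ invariantForms ν) :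
    ∃ M : Matrix (Fin 6) (Fin 6) ℝ,
      HasDerivAt (fun s : ℝ => frame (g + s • k)) M 0 ∧ ((frame g)⁻¹ * M).IsSymm := by
  obtain ⟨a, ha, rfl⟩ := (mem_invariantMetrics_iff hν g).1 hg
  obtain ⟨v, rfl⟩ := (mem_invariantForms_iff hν k).1 hk
  have hev : (fun s : ℝ => frame (diagForm a + s • diagForm v)) =ᶠ[𝓝 0]
      fun s => diagonal fun i => (√(a (block i) + s * v (block i)))⁻¹ := by
    filter_upwards [eventually_add_smul_pos ha v] with s hs
    rw [diagForm_add_smul, frame_diagForm hs, diagForm_eq]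
    rfl
  have hd : ∀ i : Fin 6, ∃ m,
      HasDerivAt (fun s : ℝ => (√(a (block i) + s * v (block i)))⁻¹) m 0 := by
    intro i
    have h0 : a (block i) + 0 * v (block i) ≠ 0 := by simpa using (ha (block i)).ne'
    have h1 : DifferentiableAt ℝ (fun s : ℝ => a (block i) + s * v (block i)) 0 := by
      fun_prop
    have h2 : √(a (block i) + 0 * v (block i)) ≠ 0 := by
      simpa using (Real.sqrt_pos.2 (ha (block i))).ne'
    exact ⟨_, ((h1.sqrt h0).inv h2).hasDerivAt⟩
  choose m hm using hd
  refine ⟨diagonal m, ?_, ?_⟩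
  · rw [hasDerivAt_matrix_iff]
    intro i j
    refine HasDerivAt.congr_of_eventuallyEq ?_ (hev.mono fun s hs => congrFun₂ hs i j)
    by_cases hij : i = j
    · subst hij
      simpa using hm i
    · simpa [hij] using hasDerivAt_const (0 : ℝ) (0 : ℝ)
  · rw [frame_diagForm_inv ha, diagForm, diagonal_mul_diagonal]
    exact isSymm_diagonal _

/-! ### Clifford multiplication and spinors in coordinates -/

/-- The spinor whose coordinates, in lexicographic order of `SpinIdx`, are the given numbers. -/
def ofCoords (z₀ z₁ z₂ z₃ z₄ z₅ z₆ z₇ : ℂ) : Spinor := WithLp.toLp 2 fun p =>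
  (![![![z₀, z₁], ![z₂, z₃]], ![![z₄, z₅], ![z₆, z₇]]] : Fin 2 → Fin 2 → Fin 2 → ℂ) p.1 p.2.1 p.2.2

lemma spinor_eq_ofCoords (φ : Spinor) : φ = ofCoords (φ (0, 0, 0)) (φ (0, 0, 1)) (φ (0, 1, 0))
    (φ (0, 1, 1)) (φ (1, 0, 0)) (φ (1, 0, 1)) (φ (1, 1, 0)) (φ (1, 1, 1)) := by
  ext ⟨i, j, k⟩
  fin_cases i <;> fin_cases j <;> fin_cases k <;> rfl

lemma ofCoords_add (z₀ z₁ z₂ z₃ z₄ z₅ z₆ z₇ w₀ w₁ w₂ w₃ w₄ w₅ w₆ w₇ : ℂ) :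
    ofCoords z₀ z₁ z₂ z₃ z₄ z₅ z₆ z₇ + ofCoords w₀ w₁ w₂ w₃ w₄ w₅ w₆ w₇ =
      ofCoords (z₀ + w₀) (z₁ + w₁) (z₂ + w₂) (z₃ + w₃) (z₄ + w₄) (z₅ + w₅) (z₆ + w₆)
        (z₇ + w₇) := by
  ext ⟨i, j, k⟩
  fin_cases i <;> fin_cases j <;> fin_cases k <;> rfl

lemma smul_ofCoords (c z₀ z₁ z₂ z₃ z₄ z₅ z₆ z₇ : ℂ) :
    c • ofCoords z₀ z₁ z₂ z₃ z₄ z₅ z₆ z₇ =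
      ofCoords (c * z₀) (c * z₁) (c * z₂) (c * z₃) (c * z₄) (c * z₅) (c * z₆) (c * z₇) := by
  ext ⟨i, j, k⟩
  fin_cases i <;> fin_cases j <;> fin_cases k <;> rfl

lemma neg_ofCoords (z₀ z₁ z₂ z₃ z₄ z₅ z₆ z₇ : ℂ) : -ofCoords z₀ z₁ z₂ z₃ z₄ z₅ z₆ z₇ =
    ofCoords (-z₀) (-z₁) (-z₂) (-z₃) (-z₄) (-z₅) (-z₆) (-z₇) := by
  ext ⟨i, j, k⟩
  fin_cases i <;> fin_cases j <;> fin_cases k <;> rfl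

lemma ofCoords_eq_zero_iff (z₀ z₁ z₂ z₃ z₄ z₅ z₆ z₇ : ℂ) :
    ofCoords z₀ z₁ z₂ z₃ z₄ z₅ z₆ z₇ = 0 ↔ z₀ = 0 ∧ z₁ = 0 ∧ z₂ = 0 ∧ z₃ = 0 ∧ z₄ = 0 ∧ z₅ = 0 ∧
      z₆ = 0 ∧ z₇ = 0 := by
  constructor
  · intro h
    have e : ∀ p, (ofCoords z₀ z₁ z₂ z₃ z₄ z₅ z₆ z₇) p = 0 := fun p => by rw [h]; rfl
    exact ⟨e (0, 0, 0), e (0, 0, 1), e (0, 1, 0), e (0, 1, 1), e (1, 0, 0), e (1, 0, 1),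
      e (1, 1, 0), e (1, 1, 1)⟩
  · rintro ⟨rfl, rfl, rfl, rfl, rfl, rfl, rfl, rfl⟩
    ext ⟨i, j, k⟩
    fin_cases i <;> fin_cases j <;> fin_cases k <;> rfl

lemma norm_ofCoords_sq (z₀ z₁ z₂ z₃ z₄ z₅ z₆ z₇ : ℂ) :
    ‖ofCoords z₀ z₁ z₂ z₃ z₄ z₅ z₆ z₇‖ ^ 2 = ‖z₀‖ ^ 2 + ‖z₁‖ ^ 2 + ‖z₂‖ ^ 2 + ‖z₃‖ ^ 2 +
      ‖z₄‖ ^ 2 + ‖z₅‖ ^ 2 + ‖z₆‖ ^ 2 + ‖z₇‖ ^ 2 := by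
  rw [EuclideanSpace.norm_sq_eq]
  simp only [Fintype.sum_prod_type, Fin.sum_univ_two, ofCoords]
  simp
  ring

lemma phi1_eq : phi1 = ofCoords (1 / 2) 0 0 (-(1 / 2)) 0 (-(1 / 2)) (-(1 / 2)) 0 := by
  ext ⟨i, j, k⟩
  fin_cases i <;> fin_cases j <;> fin_cases k <;> simp [phi1, ofCoords]

lemma phi2_eq : phi2 = ofCoords 0 (1 / 2) (1 / 2) 0 (1 / 2) 0 0 (-(1 / 2)) := by
  ext ⟨i, j, k⟩
  fin_cases i <;> fin_cases j <;> fin_cases k <;> simp [phi2, ofCoords]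

lemma act_add (M N : Matrix SpinIdx SpinIdx ℂ) (φ : Spinor) :
    act (M + N) φ = act M φ + act N φ := by
  simp [act]

lemma act_smul (c : ℂ) (M : Matrix SpinIdx SpinIdx ℂ) (φ : Spinor) :
    act (c • M) φ = c • act M φ := by
  simp [act]

lemma act_neg (M : Matrix SpinIdx SpinIdx ℂ) (φ : Spinor) : act (-M) φ = -act M φ := by
  simp [act]

lemma act_mul (M N : Matrix SpinIdx SpinIdx ℂ) (φ : Spinor) :
    act (M * N) φ = act M (act N φ) := by
  simp [act, toLpLin_apply, mulVec_mulVec]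

lemma act_clifford_zero (z₀ z₁ z₂ z₃ z₄ z₅ z₆ z₇ : ℂ) :
    act (clifford 0) (ofCoords z₀ z₁ z₂ z₃ z₄ z₅ z₆ z₇) =
      ofCoords (-(Complex.I * z₃)) (Complex.I * z₂) (Complex.I * z₁) (-(Complex.I * z₀))
        (Complex.I * z₇) (-(Complex.I * z₆)) (-(Complex.I * z₅)) (Complex.I * z₄) := by
  ext ⟨i, j, k⟩
  fin_cases i <;> fin_cases j <;> fin_cases k <;>
    simp [act, ofCoords, toLpLin_apply, mulVec, dotProduct, Fintype.sum_prod_type, clifford,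
      cT, cg1]

lemma act_clifford_one (z₀ z₁ z₂ z₃ z₄ z₅ z₆ z₇ : ℂ) :
    act (clifford 1) (ofCoords z₀ z₁ z₂ z₃ z₄ z₅ z₆ z₇) =
      ofCoords (-(Complex.I * z₇)) (Complex.I * z₆) (Complex.I * z₅) (-(Complex.I * z₄))
        (-(Complex.I * z₃)) (Complex.I * z₂) (Complex.I * z₁) (-(Complex.I * z₀)) := by
  ext ⟨i, j, k⟩
  fin_cases i <;> fin_cases j <;> fin_cases k <;>
    simp [act, ofCoords, toLpLin_apply, mulVec, dotProduct, Fintype.sum_prod_type, clifford,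
      cT, cg2]

lemma act_clifford_two (z₀ z₁ z₂ z₃ z₄ z₅ z₆ z₇ : ℂ) :
    act (clifford 2) (ofCoords z₀ z₁ z₂ z₃ z₄ z₅ z₆ z₇) =
      ofCoords z₁ (-z₀) (-z₃) z₂ z₅ (-z₄) (-z₇) z₆ := by
  ext ⟨i, j, k⟩
  fin_cases i <;> fin_cases j <;> fin_cases k <;>
    simp [act, ofCoords, toLpLin_apply, mulVec, dotProduct, Fintype.sum_prod_type, clifford,
      cT, cg1, Matrix.one_apply]

lemma act_clifford_three (z₀ z₁ z₂ z₃ z₄ z₅ z₆ z₇ : ℂ) :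
    act (clifford 3) (ofCoords z₀ z₁ z₂ z₃ z₄ z₅ z₆ z₇) =
      ofCoords z₃ (-z₂) z₁ (-z₀) z₇ (-z₆) z₅ (-z₄) := by
  ext ⟨i, j, k⟩
  fin_cases i <;> fin_cases j <;> fin_cases k <;>
    simp [act, ofCoords, toLpLin_apply, mulVec, dotProduct, Fintype.sum_prod_type, clifford,
      cT, cg2, Matrix.one_apply]

lemma act_clifford_four (z₀ z₁ z₂ z₃ z₄ z₅ z₆ z₇ : ℂ) :
    act (clifford 4) (ofCoords z₀ z₁ z₂ z₃ z₄ z₅ z₆ z₇) =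
      ofCoords (Complex.I * z₀) (-(Complex.I * z₁)) (Complex.I * z₂) (-(Complex.I * z₃))
        (Complex.I * z₄) (-(Complex.I * z₅)) (Complex.I * z₆) (-(Complex.I * z₇)) := by
  ext ⟨i, j, k⟩
  fin_cases i <;> fin_cases j <;> fin_cases k <;>
    simp [act, ofCoords, toLpLin_apply, mulVec, dotProduct, Fintype.sum_prod_type, clifford,
      cg1, Matrix.one_apply]

lemma act_clifford_five (z₀ z₁ z₂ z₃ z₄ z₅ z₆ z₇ : ℂ) :
    act (clifford 5) (ofCoords z₀ z₁ z₂ z₃ z₄ z₅ z₆ z₇) =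
      ofCoords (Complex.I * z₁) (Complex.I * z₀) (Complex.I * z₃) (Complex.I * z₂)
        (Complex.I * z₅) (Complex.I * z₄) (Complex.I * z₇) (Complex.I * z₆) := by
  ext ⟨i, j, k⟩
  fin_cases i <;> fin_cases j <;> fin_cases k <;>
    simp [act, ofCoords, toLpLin_apply, mulVec, dotProduct, Fintype.sum_prod_type, clifford,
      cg2, Matrix.one_apply]

lemma norm_act_clifford_sq (i : Fin 6) (φ : Spinor) : ‖act (clifford i) φ‖ ^ 2 = ‖φ‖ ^ 2 := by
  rw [spinor_eq_ofCoords φ]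
  fin_cases i <;>
    simp [act_clifford_zero, act_clifford_one, act_clifford_two, act_clifford_three,
      act_clifford_four, act_clifford_five, norm_ofCoords_sq] <;> ring

lemma spinRep_smul (c : ℝ) (M : Matrix (Fin 6) (Fin 6) ℝ) :
    spinRep (c • M) = (c : ℂ) • spinRep M := by
  simp only [spinRep, Finset.smul_sum, smul_smul, Matrix.smul_apply, smul_eq_mul]
  refine Finset.sum_congr rfl fun j _ => Finset.sum_congr rfl fun k _ => ?_
  congr 1
  push_cast
  ring

lemma spinRep_eq (M : Matrix (Fin 6) (Fin 6) ℝ) : spinRep M = (-(1 / 2) : ℂ) • (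
    (M 0 1 : ℂ) • (clifford 0 * clifford 1) + (M 0 2 : ℂ) • (clifford 0 * clifford 2) +
    (M 0 3 : ℂ) • (clifford 0 * clifford 3) + (M 0 4 : ℂ) • (clifford 0 * clifford 4) +
    (M 0 5 : ℂ) • (clifford 0 * clifford 5) + (M 1 2 : ℂ) • (clifford 1 * clifford 2) +
    (M 1 3 : ℂ) • (clifford 1 * clifford 3) + (M 1 4 : ℂ) • (clifford 1 * clifford 4) +
    (M 1 5 : ℂ) • (clifford 1 * clifford 5) + (M 2 3 : ℂ) • (clifford 2 * clifford 3) +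
    (M 2 4 : ℂ) • (clifford 2 * clifford 4) + (M 2 5 : ℂ) • (clifford 2 * clifford 5) +
    (M 3 4 : ℂ) • (clifford 3 * clifford 4) + (M 3 5 : ℂ) • (clifford 3 * clifford 5) +
    (M 4 5 : ℂ) • (clifford 4 * clifford 5)) := by
  have h0 : Finset.Ioi (0 : Fin 6) = {1, 2, 3, 4, 5} := by decide
  have h1 : Finset.Ioi (1 : Fin 6) = {2, 3, 4, 5} := by decide
  have h2 : Finset.Ioi (2 : Fin 6) = {3, 4, 5} := by decide
  have h3 : Finset.Ioi (3 : Fin 6) = {4, 5} := by decide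
  have h4 : Finset.Ioi (4 : Fin 6) = {5} := by decide
  have h5 : Finset.Ioi (5 : Fin 6) = ∅ := by decide
  simp only [spinRep, Fin.sum_univ_six, h0, h1, h2, h3, h4, h5, Finset.sum_empty,
    Finset.sum_singleton]
  repeat rw [Finset.sum_insert (by decide)]
  simp only [Finset.sum_singleton, Complex.ofReal_mul, ← smul_smul, ← smul_add]
  push_cast
  abel_nf

/-! ### Invariant spinors -/

lemma act_spinRep_blockMul (u : Fin 3 → ℂ) (z₀ z₁ z₂ z₃ z₄ z₅ z₆ z₇ : ℂ) :
    act (spinRep (blockMul u)) (ofCoords z₀ z₁ z₂ z₃ z₄ z₅ z₆ z₇) = (1 / 2 : ℂ) • ofCoords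
      ((u 0).im * z₄ + (u 1).im * z₂ + (u 2).im * z₁)
      ((u 0).im * z₅ + (u 1).im * z₃ - (u 2).im * z₀)
      ((u 0).im * z₆ - (u 1).im * z₀ + (u 2).im * z₃)
      ((u 0).im * z₇ - (u 1).im * z₁ - (u 2).im * z₂)
      (-(u 0).im * z₀ + (u 1).im * z₆ + (u 2).im * z₅)
      (-(u 0).im * z₁ + (u 1).im * z₇ - (u 2).im * z₄)
      (-(u 0).im * z₂ - (u 1).im * z₄ + (u 2).im * z₇)
      (-(u 0).im * z₃ - (u 1).im * z₅ - (u 2).im * z₆) := by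
  rw [spinRep_eq]
  simp only [blockMul, of_apply, cons_val, Complex.ofReal_zero, zero_smul, add_zero,
    act_add, act_smul, act_mul, act_clifford_zero, act_clifford_one, act_clifford_two,
    act_clifford_three, act_clifford_four, act_clifford_five, smul_ofCoords, ofCoords_add]
  congr 1 <;> ring_nf <;> simp only [Complex.I_sq] <;> ring

/-- For a fixed element of the Lie algebra with angles `x₀, x₁, x₂`, `x₀ + x₁ + x₂ = 0`, each
equation is a linear relation between three coordinates of the spinor. Two generic choices force
these three to agree up to sign, so that only two parameters remain. -/
lemma mem_invariantSpinors_iff {ν : ℝ} (hν : ν ≠ 0) {a : Fin 3 → ℝ} (ha : ∀ i, 0 < a i)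
    (φ : Spinor) : φ ∈ invariantSpinors ν (diagForm a) ↔
      ∃ α β : ℂ, α • phi1 + β • phi2 = φ := by
  have hact : ∀ d : Fin 3 → ℂ, (∀ i, (d i).re = 0) →
      act (spinRep ((frame (diagForm a))⁻¹ * isotropyAlg ν (diagonal d) * frame (diagForm a))) φ =
      act (spinRep (blockMul ![d 2 - d 1, d 0 - d 2, d 1 - d 0])) φ := by
    intro d hd
    rw [isotropyAlg_diagonal hν hd, frame_inv_mul_blockMul_mul_frame ha]
  simp only [invariantSpinors, Submodule.mem_iInf, LinearMap.mem_ker]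
  constructor
  · intro h
    have key : ∀ x y : ℝ, act (spinRep (blockMul ![-(x + y) * Complex.I - y * Complex.I,
        x * Complex.I - -(x + y) * Complex.I, y * Complex.I - x * Complex.I])) φ = 0 := by
      intro x y
      have hre : ∀ i, ((![x * Complex.I, y * Complex.I, -(x + y) * Complex.I] : Fin 3 → ℂ) i).re
          = 0 := by
        intro i
        fin_cases i <;> simp
      have hX := h (diagonal ![x * Complex.I, y * Complex.I, -(x + y) * Complex.I])
        ⟨isDiag_diagonal _, ?_, ?_⟩
      · rw [hact _ hre] at hX
        exact hX
      · rw [diagonal_conjTranspose, diagonal_neg]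
        congr 1
        funext i
        fin_cases i <;> simp
      · simp [Fin.sum_univ_three]
        ring
    have h1 := key 1 (-1)
    have h2 := key 0 1
    rw [spinor_eq_ofCoords φ, act_spinRep_blockMul, smul_ofCoords, ofCoords_eq_zero_iff] at h1 h2
    simp at h1 h2
    obtain ⟨p0, p1, p2, p3, p4, p5, p6, p7⟩ := h1
    obtain ⟨q0, q1, q2, q3, q4, q5, q6, q7⟩ := h2
    refine ⟨2 * φ (0, 0, 0), 2 * φ (0, 0, 1), ?_⟩
    conv_rhs => rw [spinor_eq_ofCoords φ]
    rw [phi1_eq, phi2_eq, smul_ofCoords, smul_ofCoords, ofCoords_add]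
    congr 1
    · ring
    · ring
    · linear_combination (-2 / 3) * p0 - (1 / 3) * q0
    · linear_combination (-2 / 3) * p1 - (1 / 3) * q1
    · linear_combination (-1 / 3) * p0 + (1 / 3) * q0
    · linear_combination (-1 / 3) * p1 + (1 / 3) * q1
    · linear_combination (1 / 3) * p1 - (1 / 3) * q1 - q4
    · linear_combination (-1 / 3) * p0 + (1 / 3) * q0 - q5
  · rintro ⟨α, β, rfl⟩ X ⟨hdiag, hskew, htr⟩
    obtain ⟨d, rfl⟩ : ∃ d, X = diagonal d := ⟨X.diag, hdiag.diagonal_diag.symm⟩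
    have hre : ∀ i, (d i).re = 0 := by
      intro i
      have e := congrArg Complex.re (congrFun₂ hskew i i)
      simp at e
      linarith
    rw [hact d hre, phi1_eq, phi2_eq, smul_ofCoords, smul_ofCoords, ofCoords_add,
      act_spinRep_blockMul, smul_ofCoords, ofCoords_eq_zero_iff]
    simp
    refine ⟨?_, ?_, ?_, ?_, ?_, ?_, ?_, ?_⟩ <;> ring

lemma invariantSpinors_diagForm {ν : ℝ} (hν : ν ≠ 0) {a : Fin 3 → ℝ} (ha : ∀ i, 0 < a i) :
    invariantSpinors ν (diagForm a) = Submodule.span ℂ {phi1, phi2} := by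
  ext φ
  rw [mem_invariantSpinors_iff hν ha, Submodule.mem_span_pair]

lemma norm_phi_sq (α β : ℂ) : ‖α • phi1 + β • phi2‖ ^ 2 = ‖α‖ ^ 2 + ‖β‖ ^ 2 := by
  rw [phi1_eq, phi2_eq, smul_ofCoords, smul_ofCoords, ofCoords_add, norm_ofCoords_sq]
  simp
  ring

lemma norm_phi1 : ‖phi1‖ = 1 := by
  have h := norm_phi_sq 1 0
  simp at h
  exact h.resolve_right (by linarith [norm_nonneg phi1])

lemma norm_phi2 : ‖phi2‖ = 1 := by
  have h := norm_phi_sq 0 1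
  simp at h
  exact h.resolve_right (by linarith [norm_nonneg phi2])

lemma finrank_span_phi : Module.finrank ℂ (Submodule.span ℂ {phi1, phi2}) = 2 := by
  have hli : LinearIndependent ℂ ![phi1, phi2] := by
    rw [LinearIndependent.pair_iff]
    intro α β h
    have hn := norm_phi_sq α β
    rw [h, norm_zero] at hn
    constructor
    · rw [← norm_eq_zero]
      nlinarith [norm_nonneg α, sq_nonneg ‖β‖]
    · rw [← norm_eq_zero]
      nlinarith [norm_nonneg β, sq_nonneg ‖α‖]
  have h := finrank_span_eq_card hli
  rwa [Matrix.range_cons, Matrix.range_cons, Matrix.range_empty, Set.union_empty,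
    Set.singleton_union, Fintype.card_fin] at h

/-! ### The energy -/

/-- The spin lift of `[E_i, ·]_p` acts on the invariant spinors as Clifford multiplication by `E_i`
combined with the exchange of `φ₁` and `φ₂`. -/
lemma act_spinRep_bracketMat (i : Fin 6) (α β : ℂ) :
    act (spinRep (bracketMat i)) (α • phi1 + β • phi2) =
      act (clifford i) (β • phi1 + α • phi2) := by
  rw [phi1_eq, phi2_eq, smul_ofCoords, smul_ofCoords, smul_ofCoords, smul_ofCoords, ofCoords_add,
    ofCoords_add, spinRep_eq]
  fin_cases i <;>
  · simp [bracketMat, bracketConst, act_add, act_neg, act_smul, act_mul, act_clifford_zero,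
      act_clifford_one, act_clifford_two, act_clifford_three, act_clifford_four, act_clifford_five,
      smul_ofCoords, neg_ofCoords, ofCoords_add]
    congr 1 <;> ring_nf <;> try simp only [Complex.I_sq]; ring_nf

lemma covDeriv_diagForm {ν : ℝ} (hν : ν ≠ 0) {a : Fin 3 → ℝ} (ha : ∀ i, 0 < a i) (i : Fin 6)
    (α β : ℂ) : covDeriv ν (diagForm a) i (α • phi1 + β • phi2) =
      (connFactor ν a (block i) : ℂ) • act (clifford i) (β • phi1 + α • phi2) := by
  rw [covDeriv, leviCivita_diagForm hν ha, spinRep_smul, act_smul, act_spinRep_bracketMat]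

/-- The energy of the metric with parameters `a` and an invariant unit spinor, up to the constant
factor `4 ν² V`. -/
def energyPoly (a : Fin 3 → ℝ) : ℝ :=
  3 / 16 * (a 0 ^ 2 + a 1 ^ 2 + a 2 ^ 2) - 1 / 8 * (a 1 * a 2 + a 0 * a 1 + a 0 * a 2)

lemma energy_diagForm {ν : ℝ} (V : ℝ) (hν : ν ≠ 0) {a : Fin 3 → ℝ} (ha : ∀ i, 0 < a i)
    {φ : Spinor} (hφ : φ ∈ invariantSpinors ν (diagForm a)) :
    energy ν V (diagForm a) φ = 4 * ν ^ 2 * V * energyPoly a * ‖φ‖ ^ 2 := by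
  obtain ⟨α, β, rfl⟩ := (mem_invariantSpinors_iff hν ha φ).1 hφ
  have hi : ∀ i, ‖covDeriv ν (diagForm a) i (α • phi1 + β • phi2)‖ ^ 2 =
      connFactor ν a (block i) ^ 2 * (‖α‖ ^ 2 + ‖β‖ ^ 2) := by
    intro i
    rw [covDeriv_diagForm hν ha, norm_smul, mul_pow, norm_act_clifford_sq, norm_phi_sq,
      Complex.norm_real, Real.norm_eq_abs, sq_abs, add_comm]
  have hc : ∀ c, connFactor ν a c ^ 2 * (4 * (a 0 * a 1 * a 2)) =
      ν ^ 2 * (2 * a c - (a 0 + a 1 + a 2)) ^ 2 := by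
    intro c
    have h0 := Real.sqrt_pos.2 (ha 0)
    have h1 := Real.sqrt_pos.2 (ha 1)
    have h2 := Real.sqrt_pos.2 (ha 2)
    rw [connFactor, div_pow, mul_pow 2, mul_pow, mul_pow, mul_pow, Real.sq_sqrt (ha 0).le,
      Real.sq_sqrt (ha 1).le, Real.sq_sqrt (ha 2).le]
    have := ha 0
    have := ha 1
    have := ha 2
    field_simp
    try ring
  rw [energy, volume_diagForm V ha, Finset.sum_congr rfl fun i _ => hi i, norm_phi_sq]
  simp only [Fin.sum_univ_six, block, cons_val, energyPoly]
  linear_combination (V * (‖α‖ ^ 2 + ‖β‖ ^ 2) / 4) * (hc 0 + hc 1 + hc 2)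

/-! ### The gradient of the energy -/

lemma mem_unitSpinors_iff {ν : ℝ} (hν : ν ≠ 0) {a : Fin 3 → ℝ} {φ : Spinor} :
    (diagForm a, φ) ∈ unitSpinors ν ↔
      (∀ i, 0 < a i) ∧ φ ∈ Submodule.span ℂ {phi1, phi2} ∧ ‖φ‖ = 1 := by
  constructor
  · rintro ⟨hg, hφ, hn⟩
    have ha := (diagForm_mem_invariantMetrics hν).1 hg
    exact ⟨ha, invariantSpinors_diagForm hν ha ▸ hφ, hn⟩
  · rintro ⟨ha, hφ, hn⟩
    exact ⟨(diagForm_mem_invariantMetrics hν).2 ha,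
      (invariantSpinors_diagForm hν ha).symm ▸ hφ, hn⟩

lemma volume_diagForm_eq_iff {V : ℝ} (hV : V ≠ 0) {a : Fin 3 → ℝ} (ha : ∀ i, 0 < a i) :
    volume V (diagForm a) = V ↔ a 0 * a 1 * a 2 = 1 := by
  rw [volume_diagForm V ha, mul_eq_left₀ hV]

lemma diagForm_inv {a : Fin 3 → ℝ} (ha : ∀ i, 0 < a i) :
    (diagForm a)⁻¹ = diagForm fun c => (a c)⁻¹ := by
  refine Matrix.inv_eq_right_inv ?_
  rw [diagForm_eq, diagForm_eq, diagonal_mul_diagonal, ← diagonal_one]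
  congr 1
  funext i
  exact mul_inv_cancel₀ (ha _).ne'

lemma l2Form_diagForm (V : ℝ) {a : Fin 3 → ℝ} (ha : ∀ i, 0 < a i) (p q : Fin 3 → ℝ) :
    l2Form V (diagForm a) (diagForm p) (diagForm q) = V * (a 0 * a 1 * a 2) *
      (2 * (p 0 * q 0 / a 0 ^ 2 + p 1 * q 1 / a 1 ^ 2 + p 2 * q 2 / a 2 ^ 2)) := by
  rw [l2Form, volume_diagForm V ha, diagForm_inv ha]
  simp only [diagForm, diagonal_mul_diagonal, trace_diagonal, Fin.sum_univ_six, cons_val]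
  congr 1
  have := ha 0
  have := ha 1
  have := ha 2
  field_simp
  ring

lemma flowField_zero (ν : ℝ) (a : Fin 3 → ℝ) : flowField ν a 0 =
    4 * ν ^ 2 * (-(1 / 16) * (a 0 / (a 1 * a 2)) * (3 * a 0 - a 1 - a 2)) := rfl

lemma flowField_one (ν : ℝ) (a : Fin 3 → ℝ) : flowField ν a 1 =
    4 * ν ^ 2 * (-(1 / 16) * (a 1 / (a 2 * a 0)) * (3 * a 1 - a 2 - a 0)) := rfl

lemma flowField_two (ν : ℝ) (a : Fin 3 → ℝ) : flowField ν a 2 =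
    4 * ν ^ 2 * (-(1 / 16) * (a 2 / (a 0 * a 1)) * (3 * a 2 - a 0 - a 1)) := rfl

lemma flowFieldNormalized_zero (ν : ℝ) (a : Fin 3 → ℝ) : flowFieldNormalized ν a 0 =
    4 * ν ^ 2 * ((1 / 48) * (-2 - 6 * (a 0 ^ 2 / (a 1 * a 2)) + a 0 * (a 1 + a 2) / (a 1 * a 2)
      + 3 * ((a 1 ^ 2 + a 2 ^ 2) / (a 1 * a 2)))) := rfl

lemma flowFieldNormalized_one (ν : ℝ) (a : Fin 3 → ℝ) : flowFieldNormalized ν a 1 =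
    4 * ν ^ 2 * ((1 / 48) * (-2 - 6 * (a 1 ^ 2 / (a 2 * a 0)) + a 1 * (a 2 + a 0) / (a 2 * a 0)
      + 3 * ((a 2 ^ 2 + a 0 ^ 2) / (a 2 * a 0)))) := rfl

lemma flowFieldNormalized_two (ν : ℝ) (a : Fin 3 → ℝ) : flowFieldNormalized ν a 2 =
    4 * ν ^ 2 * ((1 / 48) * (-2 - 6 * (a 2 ^ 2 / (a 0 * a 1)) + a 2 * (a 0 + a 1) / (a 0 * a 1)
      + 3 * ((a 0 ^ 2 + a 1 ^ 2) / (a 0 * a 1)))) := rfl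

lemma hasDerivAt_energyPoly (a v : Fin 3 → ℝ) :
    HasDerivAt (fun s : ℝ => energyPoly (a + s • v))
      (1 / 8 * ((3 * a 0 - a 1 - a 2) * v 0 + (3 * a 1 - a 2 - a 0) * v 1 +
        (3 * a 2 - a 0 - a 1) * v 2)) 0 := by
  have e : (fun s : ℝ => energyPoly (a + s • v)) = fun s =>
      energyPoly a + s * (1 / 8 * ((3 * a 0 - a 1 - a 2) * v 0 + (3 * a 1 - a 2 - a 0) * v 1 +
        (3 * a 2 - a 0 - a 1) * v 2)) + s ^ 2 * energyPoly v := by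
    funext s
    simp only [energyPoly, Pi.add_apply, Pi.smul_apply, smul_eq_mul]
    ring
  rw [e]
  have h1 := ((hasDerivAt_id (0 : ℝ)).mul_const (1 / 8 * ((3 * a 0 - a 1 - a 2) * v 0 +
    (3 * a 1 - a 2 - a 0) * v 1 + (3 * a 2 - a 0 - a 1) * v 2))).const_add (energyPoly a)
  have h2 := ((hasDerivAt_id (0 : ℝ)).pow 2).mul_const (energyPoly v)
  exact (h1.add h2).congr_deriv (by simp)

lemma hasDerivAt_energy_metric {ν : ℝ} (V : ℝ) (hν : ν ≠ 0) {a : Fin 3 → ℝ} {φ : Spinor}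
    (h : (diagForm a, φ) ∈ unitSpinors ν) (v : Fin 3 → ℝ) :
    HasDerivAt (fun s : ℝ => energy ν V (diagForm a + s • diagForm v) φ)
      (-l2Form V (diagForm a) (diagForm (flowField ν a)) (diagForm v)) 0 := by
  obtain ⟨ha, hφ, hn⟩ := (mem_unitSpinors_iff hν).1 h
  have hev : (fun s : ℝ => energy ν V (diagForm a + s • diagForm v) φ) =ᶠ[𝓝 0]
      fun s => 4 * ν ^ 2 * V * energyPoly (a + s • v) := by
    filter_upwards [eventually_add_smul_pos ha v] with s hs
    rw [diagForm_add_smul, energy_diagForm V hν hs, hn, one_pow, mul_one]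
    rwa [invariantSpinors_diagForm hν hs]
  refine HasDerivAt.congr_of_eventuallyEq ?_ hev
  refine ((hasDerivAt_energyPoly a v).const_mul (4 * ν ^ 2 * V)).congr_deriv ?_
  rw [l2Form_diagForm V ha, flowField_zero, flowField_one, flowField_two]
  have := ha 0
  have := ha 1
  have := ha 2
  field_simp
  ring

lemma reInner_self (φ : Spinor) : reInner φ φ = ‖φ‖ ^ 2 :=
  (norm_sq_eq_re_inner (𝕜 := ℂ) φ).symm

/-- The energy depends on the invariant spinor only through its norm. -/
lemma hasDerivAt_energy_spinor {ν : ℝ} (V : ℝ) (hν : ν ≠ 0) {a : Fin 3 → ℝ}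
    (ha : ∀ i, 0 < a i) {φ ψ : Spinor} (hφ : φ ∈ invariantSpinors ν (diagForm a))
    (hψ : ψ ∈ invariantSpinors ν (diagForm a)) (horth : reInner φ ψ = 0) :
    HasDerivAt (fun s : ℝ => energy ν V (diagForm a) (φ + s • ψ)) 0 0 := by
  have e : (fun s : ℝ => energy ν V (diagForm a) (φ + s • ψ)) = fun s =>
      4 * ν ^ 2 * V * energyPoly a * (‖φ‖ ^ 2 + s ^ 2 * ‖ψ‖ ^ 2) := by
    funext s
    have hs : s • ψ = (s : ℂ) • ψ := (Complex.coe_smul s ψ).symm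
    rw [energy_diagForm V hν ha, hs, norm_add_sq (𝕜 := ℂ), inner_smul_right, norm_smul, mul_pow,
      Complex.norm_real, Real.norm_eq_abs, sq_abs]
    · have : RCLike.re ((s : ℂ) * inner ℂ φ ψ) = s * reInner φ ψ := by
        simp [reInner]
      rw [this, horth]
      ring
    · rw [hs]
      exact Submodule.add_mem _ hφ (Submodule.smul_mem _ _ hψ)
  rw [e]
  have h2 := ((((hasDerivAt_id (0 : ℝ)).pow 2).mul_const (‖ψ‖ ^ 2)).const_add
    (‖φ‖ ^ 2)).const_mul (4 * ν ^ 2 * V * energyPoly a)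
  simpa using h2

lemma eq_zero_of_l2Form_self_eq_zero {V : ℝ} (hV : 0 < V) {a : Fin 3 → ℝ} (ha : ∀ i, 0 < a i)
    {w : Fin 3 → ℝ} (h : l2Form V (diagForm a) (diagForm w) (diagForm w) = 0) : w = 0 := by
  rw [l2Form_diagForm V ha] at h
  have h0 := ha 0
  have h1 := ha 1
  have h2 := ha 2
  have hpos : 0 < V * (a 0 * a 1 * a 2) := by positivity
  have hs := (mul_eq_zero.1 h).resolve_left hpos.ne'
  have p0 : 0 ≤ w 0 * w 0 / a 0 ^ 2 := div_nonneg (mul_self_nonneg _) (sq_nonneg _)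
  have p1 : 0 ≤ w 1 * w 1 / a 1 ^ 2 := div_nonneg (mul_self_nonneg _) (sq_nonneg _)
  have p2 : 0 ≤ w 2 * w 2 / a 2 ^ 2 := div_nonneg (mul_self_nonneg _) (sq_nonneg _)
  have z0 : w 0 * w 0 / a 0 ^ 2 = 0 := by linarith
  have z1 : w 1 * w 1 / a 1 ^ 2 = 0 := by linarith
  have z2 : w 2 * w 2 / a 2 ^ 2 = 0 := by linarith
  funext c
  fin_cases c
  · simpa [h0.ne'] using z0
  · simpa [h1.ne'] using z1
  · simpa [h2.ne'] using z2

lemma l2Form_sub_left (V : ℝ) {a : Fin 3 → ℝ} (ha : ∀ i, 0 < a i) (p q r : Fin 3 → ℝ) :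
    l2Form V (diagForm a) (diagForm (p - q)) (diagForm r) =
      l2Form V (diagForm a) (diagForm p) (diagForm r) -
        l2Form V (diagForm a) (diagForm q) (diagForm r) := by
  simp only [l2Form_diagForm V ha, Pi.sub_apply]
  ring

/-- The spinorial part of a negative gradient is its own test vector, and the corresponding
derivative of the energy vanishes. -/
lemma spinor_eq_zero_of_deriv {ν V : ℝ} (hν : ν ≠ 0) (hV : 0 < V) {a : Fin 3 → ℝ}
    (ha : ∀ i, 0 < a i) {φ Q : Spinor} (hφ : φ ∈ invariantSpinors ν (diagForm a))
    (hQ : Q ∈ invariantSpinors ν (diagForm a)) (horth : reInner φ Q = 0)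
    (hd : ∀ ψ ∈ invariantSpinors ν (diagForm a), reInner φ ψ = 0 →
      HasDerivAt (fun s : ℝ => energy ν V (diagForm a) (φ + s • ψ))
        (-(volume V (diagForm a) * reInner Q ψ)) 0) : Q = 0 := by
  have h0 := (hd Q hQ horth).unique (hasDerivAt_energy_spinor V hν ha hφ hQ horth)
  rw [volume_diagForm V ha, reInner_self] at h0
  have := ha 0
  have := ha 1
  have := ha 2
  have hpos : V * (a 0 * a 1 * a 2) ≠ 0 := by positivity
  simpa [hpos] using h0

lemma isNegGradient_iff {ν V : ℝ} (hν : ν ≠ 0) (hV : 0 < V) {a : Fin 3 → ℝ} {φ : Spinor}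
    (h : (diagForm a, φ) ∈ unitSpinors ν) (Q₁ : Matrix (Fin 6) (Fin 6) ℝ) (Q₂ : Spinor) :
    IsNegGradient ν V (diagForm a) φ Q₁ Q₂ ↔ Q₁ = diagForm (flowField ν a) ∧ Q₂ = 0 := by
  have ha := ((mem_unitSpinors_iff hν).1 h).1
  constructor
  · intro hQ
    obtain ⟨q, rfl⟩ := (mem_invariantForms_iff hν Q₁).1 hQ.form_mem
    have hw : q - flowField ν a = 0 := by
      refine eq_zero_of_l2Form_self_eq_zero hV ha ?_
      have := (hQ.metric_deriv (diagForm (q - flowField ν a))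
        (diagForm_mem_invariantForms hν _)).unique (hasDerivAt_energy_metric V hν h _)
      rw [l2Form_sub_left V ha]
      linarith
    exact ⟨by rw [sub_eq_zero.1 hw],
      spinor_eq_zero_of_deriv hν hV ha h.2.1 hQ.spinor_mem hQ.spinor_orth hQ.spinor_deriv⟩
  · rintro ⟨rfl, rfl⟩
    refine ⟨diagForm_mem_invariantForms hν _, Submodule.zero_mem _, by simp [reInner], ?_, ?_⟩
    · intro k hk
      obtain ⟨v, rfl⟩ := (mem_invariantForms_iff hν k).1 hk
      exact hasDerivAt_energy_metric V hν h v
    · intro ψ hψ horth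
      simpa [reInner] using hasDerivAt_energy_spinor V hν ha h.2.1 hψ horth

/-- The tangent space of the metrics of a given volume is the `L²`-orthogonal complement of the
metric. The normalized field lies in it, and differs from the field of the unnormalized flow by a
multiple of the metric, so that it is the orthogonal projection of the latter. -/
lemma l2Form_flowFieldNormalized_self (ν V : ℝ) {a : Fin 3 → ℝ} (ha : ∀ i, 0 < a i) :
    l2Form V (diagForm a) (diagForm (flowFieldNormalized ν a)) (diagForm a) = 0 := by
  rw [l2Form_diagForm V ha, flowFieldNormalized_zero, flowFieldNormalized_one,
    flowFieldNormalized_two]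
  have := ha 0
  have := ha 1
  have := ha 2
  field_simp
  ring

lemma exists_flowFieldNormalized_eq (ν : ℝ) {a : Fin 3 → ℝ} (ha : ∀ i, 0 < a i) :
    ∃ r : ℝ, flowFieldNormalized ν a = flowField ν a + r • a := by
  have := ha 0
  have := ha 1
  have := ha 2
  -- the coefficient is minus one sixth of the trace of the unnormalized field
  refine ⟨-(1 / 3) * (flowField ν a 0 / a 0 + flowField ν a 1 / a 1 + flowField ν a 2 / a 2), ?_⟩
  rw [flowField_zero, flowField_one, flowField_two]
  funext c
  fin_cases c <;> simp only [Pi.add_apply, Pi.smul_apply, smul_eq_mul, Fin.zero_eta, Fin.mk_one,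
    Fin.reduceFinMk, flowFieldNormalized_zero, flowFieldNormalized_one, flowFieldNormalized_two,
    flowField_zero, flowField_one, flowField_two] <;> field_simp <;> ring

lemma l2Form_flowField_eq (ν V : ℝ) {a : Fin 3 → ℝ} (ha : ∀ i, 0 < a i) {v : Fin 3 → ℝ}
    (hv : l2Form V (diagForm a) (diagForm v) (diagForm a) = 0) :
    l2Form V (diagForm a) (diagForm (flowField ν a)) (diagForm v) =
      l2Form V (diagForm a) (diagForm (flowFieldNormalized ν a)) (diagForm v) := by
  obtain ⟨r, hr⟩ := exists_flowFieldNormalized_eq ν ha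
  rw [l2Form_diagForm V ha] at hv
  rw [hr, l2Form_diagForm V ha, l2Form_diagForm V ha]
  simp only [Pi.add_apply, Pi.smul_apply, smul_eq_mul]
  linear_combination (-r) * hv

lemma isNegGradientNormalized_iff {ν V : ℝ} (hν : ν ≠ 0) (hV : 0 < V) {a : Fin 3 → ℝ}
    {φ : Spinor} (h : (diagForm a, φ) ∈ unitSpinors ν) (Q₁ : Matrix (Fin 6) (Fin 6) ℝ)
    (Q₂ : Spinor) : IsNegGradientNormalized ν V (diagForm a) φ Q₁ Q₂ ↔
      Q₁ = diagForm (flowFieldNormalized ν a) ∧ Q₂ = 0 := by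
  have ha := ((mem_unitSpinors_iff hν).1 h).1
  constructor
  · intro hQ
    obtain ⟨q, rfl⟩ := (mem_invariantForms_iff hν Q₁).1 hQ.form_mem
    have horth : l2Form V (diagForm a) (diagForm (q - flowFieldNormalized ν a)) (diagForm a)
        = 0 := by
      rw [l2Form_sub_left V ha, hQ.form_orth, l2Form_flowFieldNormalized_self ν V ha, sub_zero]
    have hw : q - flowFieldNormalized ν a = 0 := by
      refine eq_zero_of_l2Form_self_eq_zero hV ha ?_
      have := (hQ.metric_deriv (diagForm (q - flowFieldNormalized ν a))
        (diagForm_mem_invariantForms hν _) horth).unique (hasDerivAt_energy_metric V hν h _)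
      rw [l2Form_flowField_eq ν V ha horth] at this
      rw [l2Form_sub_left V ha]
      linarith
    exact ⟨by rw [sub_eq_zero.1 hw],
      spinor_eq_zero_of_deriv hν hV ha h.2.1 hQ.spinor_mem hQ.spinor_orth hQ.spinor_deriv⟩
  · rintro ⟨rfl, rfl⟩
    refine ⟨diagForm_mem_invariantForms hν _, l2Form_flowFieldNormalized_self ν V ha,
      Submodule.zero_mem _, by simp [reInner], ?_, ?_⟩
    · intro k hk horth
      obtain ⟨v, rfl⟩ := (mem_invariantForms_iff hν k).1 hk
      rw [← l2Form_flowField_eq ν V ha horth]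
      exact hasDerivAt_energy_metric V hν h v
    · intro ψ hψ horth
      simpa [reInner] using hasDerivAt_energy_spinor V hν ha h.2.1 hψ horth

/-! ### The flows as ordinary differential equations -/

lemma hasDerivWithinAt_diagForm_iff {a : ℝ → Fin 3 → ℝ} {a' : Fin 3 → ℝ} {I : Set ℝ} {t : ℝ} :
    HasDerivWithinAt (fun s => diagForm (a s)) (diagForm a') I t ↔ HasDerivWithinAt a a' I t := by
  rw [hasDerivWithinAt_matrix_iff, hasDerivWithinAt_pi]
  simp only [diagForm_eq]
  constructor
  · intro h c
    fin_cases c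
    · simpa [block] using h 0 0
    · simpa [block] using h 2 2
    · simpa [block] using h 4 4
  · intro h i j
    by_cases hij : i = j
    · subst hij
      simpa using h (block i)
    · simpa [hij] using hasDerivWithinAt_const t I (0 : ℝ)

/-- A curve of metrics and unit spinors whose velocity has vanishing spinorial part and metric part
given by a field `F` is the same as a solution of the differential equation defined by `F`
together with a fixed unit spinor. -/
lemma flow_iff_ode {ν : ℝ} (hν : ν ≠ 0) (F : (Fin 3 → ℝ) → Fin 3 → ℝ) (C : (Fin 3 → ℝ) → Prop)
    {I : Set ℝ} (hI : I.OrdConnected) (g : ℝ → Matrix (Fin 6) (Fin 6) ℝ) (φ : ℝ → Spinor) :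
    (∀ t ∈ I, (g t, φ t) ∈ unitSpinors ν ∧ ∃ a, g t = diagForm a ∧ C a ∧
      HasDerivWithinAt g (diagForm (F a)) I t ∧ HasDerivWithinAt φ 0 I t) ↔
    ∃ (a : ℝ → Fin 3 → ℝ) (φ₀ : Spinor), φ₀ ∈ Submodule.span ℂ {phi1, phi2} ∧ ‖φ₀‖ = 1 ∧
      ∀ t ∈ I, (∀ i, 0 < a t i) ∧ C (a t) ∧ g t = diagForm (a t) ∧ φ t = φ₀ ∧
        HasDerivWithinAt a (F (a t)) I t := by
  constructor
  · intro h
    have hpar : ∀ t, ∃ b, t ∈ I → g t = diagForm b ∧ C b ∧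
        HasDerivWithinAt g (diagForm (F b)) I t := by
      intro t
      by_cases ht : t ∈ I
      · obtain ⟨-, b, h1, h2, h3, -⟩ := h t ht
        exact ⟨b, fun _ => ⟨h1, h2, h3⟩⟩
      · exact ⟨0, fun h => absurd h ht⟩
    choose a hsol using hpar
    have hunit : ∀ t ∈ I, (∀ i, 0 < a t i) ∧ φ t ∈ Submodule.span ℂ {phi1, phi2} ∧
        ‖φ t‖ = 1 := by
      intro t ht
      have := (h t ht).1
      rw [(hsol t ht).1] at this
      exact (mem_unitSpinors_iff hν).1 this
    have hconst : ∀ s ∈ I, ∀ t ∈ I, φ t = φ s := by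
      intro s hs t ht
      have := Convex.norm_image_sub_le_of_norm_hasDerivWithin_le (f := φ) (f' := fun _ => 0)
        (C := 0) (fun x hx => (h x hx).2.choose_spec.2.2.2) (by simp) hI.convex hs ht
      simpa [sub_eq_zero] using this
    have hder : ∀ t ∈ I, HasDerivWithinAt a (F (a t)) I t := by
      intro t ht
      rw [← hasDerivWithinAt_diagForm_iff]
      rw [hasDerivWithinAt_matrix_iff]
      have h3 := hasDerivWithinAt_matrix_iff.1 (hsol t ht).2.2
      intro i j
      exact (h3 i j).congr (fun s hs => by rw [(hsol s hs).1]) (by rw [(hsol t ht).1])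
    rcases I.eq_empty_or_nonempty with rfl | ⟨t₀, ht₀⟩
    · exact ⟨a, phi1, Submodule.subset_span (by simp), norm_phi1, by simp⟩
    · exact ⟨a, φ t₀, (hunit t₀ ht₀).2.1, (hunit t₀ ht₀).2.2, fun t ht =>
        ⟨(hunit t ht).1, (hsol t ht).2.1, (hsol t ht).1, hconst t₀ ht₀ t ht, hder t ht⟩⟩
  · rintro ⟨a, φ₀, hφ₀, hn, h⟩ t ht
    obtain ⟨h1, h2, h3, h4, h5⟩ := h t ht
    refine ⟨?_, a t, h3, h2, ?_, ?_⟩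
    · rw [h3, h4]
      exact (mem_unitSpinors_iff hν).2 ⟨h1, hφ₀, hn⟩
    · have h6 := hasDerivWithinAt_matrix_iff.1 (hasDerivWithinAt_diagForm_iff.2 h5)
      rw [hasDerivWithinAt_matrix_iff]
      intro i j
      exact (h6 i j).congr (fun s hs => by rw [(h s hs).2.2.1]) (by rw [h3])
    · exact (hasDerivWithinAt_const t I φ₀).congr (fun s hs => (h s hs).2.2.2.1) h4

lemma isFlow_iff {ν V : ℝ} (hν : ν ≠ 0) (hV : 0 < V) {I : Set ℝ} (hI : I.OrdConnected)
    (g : ℝ → Matrix (Fin 6) (Fin 6) ℝ) (φ : ℝ → Spinor) : IsFlow ν V I g φ ↔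
      ∃ (a : ℝ → Fin 3 → ℝ) (φ₀ : Spinor), φ₀ ∈ Submodule.span ℂ {phi1, phi2} ∧ ‖φ₀‖ = 1 ∧
        ∀ t ∈ I, (∀ i, 0 < a t i) ∧ g t = diagForm (a t) ∧ φ t = φ₀ ∧
          HasDerivWithinAt a (flowField ν (a t)) I t := by
  have key := flow_iff_ode hν (flowField ν) (fun _ => True) hI g φ
  simp only [true_and] at key
  rw [← key, IsFlow]
  refine forall₂_congr fun t _ => and_congr_right fun hu => ?_
  obtain ⟨b, -, hb⟩ := (mem_invariantMetrics_iff hν (g t)).1 hu.1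
  rw [hb] at hu ⊢
  constructor
  · rintro ⟨Q₁, Q₂, hQ, h1, h2⟩
    obtain ⟨rfl, rfl⟩ := (isNegGradient_iff hν hV hu Q₁ Q₂).1 hQ
    exact ⟨b, rfl, h1, h2⟩
  · rintro ⟨a, ha, h1, h2⟩
    obtain rfl := diagForm_injective ha
    exact ⟨_, _, (isNegGradient_iff hν hV hu _ _).2 ⟨rfl, rfl⟩, h1, h2⟩

lemma isFlowNormalized_iff {ν V : ℝ} (hν : ν ≠ 0) (hV : 0 < V) {I : Set ℝ}
    (hI : I.OrdConnected) (g : ℝ → Matrix (Fin 6) (Fin 6) ℝ) (φ : ℝ → Spinor) :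
    IsFlowNormalized ν V I g φ ↔
      ∃ (a : ℝ → Fin 3 → ℝ) (φ₀ : Spinor), φ₀ ∈ Submodule.span ℂ {phi1, phi2} ∧ ‖φ₀‖ = 1 ∧
        ∀ t ∈ I, (∀ i, 0 < a t i) ∧ a t 0 * a t 1 * a t 2 = 1 ∧ g t = diagForm (a t) ∧
          φ t = φ₀ ∧ HasDerivWithinAt a (flowFieldNormalized ν (a t)) I t := by
  rw [← flow_iff_ode hν (flowFieldNormalized ν) (fun a => a 0 * a 1 * a 2 = 1) hI g φ,
    IsFlowNormalized]
  refine forall₂_congr fun t _ => ?_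
  rw [unitSpinorsNormalized, Set.mem_ofPred_eq, and_assoc]
  refine and_congr_right fun hu => ?_
  obtain ⟨b, hb0, hb⟩ := (mem_invariantMetrics_iff hν (g t)).1 hu.1
  simp only
  rw [hb] at hu ⊢
  rw [volume_diagForm_eq_iff hV.ne' hb0]
  constructor
  · rintro ⟨hvol, Q₁, Q₂, hQ, h1, h2⟩
    obtain ⟨rfl, rfl⟩ := (isNegGradientNormalized_iff hν hV hu Q₁ Q₂).1 hQ
    exact ⟨b, rfl, hvol, h1, h2⟩
  · rintro ⟨a, ha, hvol, h1, h2⟩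
    obtain rfl := diagForm_injective ha
    exact ⟨hvol, _, _, (isNegGradientNormalized_iff hν hV hu _ _).2 ⟨rfl, rfl⟩, h1, h2⟩

/-! ### Critical points -/

lemma not_isNegGradient_zero {ν V : ℝ} (hν : ν ≠ 0) (hV : 0 < V)
    {g : Matrix (Fin 6) (Fin 6) ℝ} {φ : Spinor} (h : (g, φ) ∈ unitSpinors ν) :
    ¬ IsNegGradient ν V g φ 0 0 := by
  obtain ⟨a, ha, rfl⟩ := (mem_invariantMetrics_iff hν g).1 h.1
  rw [isNegGradient_iff hν hV h]
  rintro ⟨hq, -⟩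
  have h0 : flowField ν a = 0 := by
    refine diagForm_injective (hq.symm.trans ?_)
    rw [diagForm_eq]
    exact diagonal_zero.symm
  have p0 := ha 0
  have p1 := ha 1
  have p2 := ha 2
  have e0 := congrFun h0 0
  have e1 := congrFun h0 1
  have e2 := congrFun h0 2
  rw [flowField_zero] at e0
  rw [flowField_one] at e1
  rw [flowField_two] at e2
  simp [hν, p0.ne', p1.ne', p2.ne'] at e0 e1 e2
  linarith

/-- Schur's inequality of degree three. -/
lemma schur_three {x y z : ℝ} (hx : 0 ≤ x) (hy : 0 ≤ y) (hz : 0 ≤ z) :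
    0 ≤ x * (x - y) * (x - z) + y * (y - x) * (y - z) + z * (z - x) * (z - y) := by
  have sorted : ∀ p q r : ℝ, 0 ≤ r → r ≤ q → q ≤ p →
      0 ≤ p * (p - q) * (p - r) + q * (q - p) * (q - r) + r * (r - p) * (r - q) := by
    intro p q r hr hrq hqp
    have e : p * (p - q) * (p - r) + q * (q - p) * (q - r) + r * (r - p) * (r - q) =
        (p - q) ^ 2 * (p + q - r) + r * ((p - r) * (q - r)) := by ring
    rw [e]
    exact add_nonneg (mul_nonneg (sq_nonneg _) (by linarith))
      (mul_nonneg hr (mul_nonneg (by linarith) (by linarith)))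
  rcases le_total x y with h1 | h1 <;> rcases le_total y z with h2 | h2 <;>
    rcases le_total x z with h3 | h3
  · linarith [sorted z y x hx h1 h2]
  · linarith [sorted z y x hx h1 h2]
  · linarith [sorted y z x hx h3 h2]
  · linarith [sorted y x z hz h3 h1]
  · linarith [sorted z x y hy h1 h3]
  · linarith [sorted x z y hy h2 h3]
  · linarith [sorted x y z hz h2 h1]
  · linarith [sorted x y z hz h2 h1]

/-- A weighted measure of how far the three parameters are from being equal. -/
def spread (a : Fin 3 → ℝ) : ℝ :=
  (a 0 + a 1) * (a 0 - a 1) ^ 2 + (a 1 + a 2) * (a 1 - a 2) ^ 2 + (a 0 + a 2) * (a 0 - a 2) ^ 2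

/-- The sum of the parameters decreases along the normalized flow, at a rate that is bounded below
by `spread`: what remains after splitting off `spread` is the expression of Schur's inequality. -/
lemma sum_flowFieldNormalized_mul_le (ν : ℝ) {a : Fin 3 → ℝ} (ha : ∀ i, 0 < a i) :
    (flowFieldNormalized ν a 0 + flowFieldNormalized ν a 1 + flowFieldNormalized ν a 2) *
      (a 0 * a 1 * a 2) ≤ -(ν ^ 2 / 6 * spread a) := by
  have p0 := ha 0
  have p1 := ha 1
  have p2 := ha 2
  have e : (flowFieldNormalized ν a 0 + flowFieldNormalized ν a 1 + flowFieldNormalized ν a 2) *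
      (a 0 * a 1 * a 2) = -(ν ^ 2 / 6 * (spread a + (a 0 * (a 0 - a 1) * (a 0 - a 2) +
        a 1 * (a 1 - a 0) * (a 1 - a 2) + a 2 * (a 2 - a 0) * (a 2 - a 1)))) := by
    rw [flowFieldNormalized_zero, flowFieldNormalized_one, flowFieldNormalized_two, spread]
    field_simp
    ring
  rw [e, neg_le_neg_iff]
  have := schur_three p0.le p1.le p2.le
  gcongr
  linarith

lemma flowFieldNormalized_eq_zero_iff {ν : ℝ} (hν : ν ≠ 0) {a : Fin 3 → ℝ} (ha : ∀ i, 0 < a i) :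
    flowFieldNormalized ν a = 0 ↔ a 0 = a 1 ∧ a 1 = a 2 := by
  have p0 := ha 0
  have p1 := ha 1
  have p2 := ha 2
  constructor
  · intro h
    have hle := sum_flowFieldNormalized_mul_le ν ha
    rw [h] at hle
    simp only [Pi.zero_apply, add_zero, zero_mul, Left.nonneg_neg_iff] at hle
    have hν2 : 0 < ν ^ 2 / 6 := by positivity
    have hs : spread a ≤ 0 := nonpos_of_mul_nonpos_right hle hν2
    have q01 : 0 ≤ (a 0 + a 1) * (a 0 - a 1) ^ 2 := by positivity
    have q12 : 0 ≤ (a 1 + a 2) * (a 1 - a 2) ^ 2 := by positivity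
    have q02 : 0 ≤ (a 0 + a 2) * (a 0 - a 2) ^ 2 := by positivity
    rw [spread] at hs
    have z01 : (a 0 + a 1) * (a 0 - a 1) ^ 2 = 0 := by linarith
    have z12 : (a 1 + a 2) * (a 1 - a 2) ^ 2 = 0 := by linarith
    have n01 := (mul_eq_zero.1 z01).resolve_left (add_pos p0 p1).ne'
    have n12 := (mul_eq_zero.1 z12).resolve_left (add_pos p1 p2).ne'
    exact ⟨sub_eq_zero.1 (pow_eq_zero_iff two_ne_zero |>.1 n01),
      sub_eq_zero.1 (pow_eq_zero_iff two_ne_zero |>.1 n12)⟩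
  · rintro ⟨h1, h2⟩
    have e : a = fun _ => a 0 := by
      funext c
      fin_cases c
      · rfl
      · exact h1.symm
      · exact (h1.trans h2).symm
    rw [e]
    funext c
    simp only [flowFieldNormalized, Pi.zero_apply]
    field_simp
    ring

lemma eq_one_iff_of_volume {a : Fin 3 → ℝ} (ha : ∀ i, 0 < a i) (hvol : a 0 * a 1 * a 2 = 1) :
    a 0 = a 1 ∧ a 1 = a 2 ↔ a = 1 := by
  constructor
  · rintro ⟨h1, h2⟩
    have h3 : a 0 ^ 3 = 1 := by
      rw [← hvol, ← h2, ← h1]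
      ring
    have h4 : a 0 = 1 := (pow_eq_one_iff_of_nonneg (ha 0).le (by norm_num)).1 h3
    funext c
    fin_cases c
    · exact h4
    · exact h1 ▸ h4
    · exact h2 ▸ h1 ▸ h4
  · rintro rfl
    exact ⟨rfl, rfl⟩

lemma three_le_add_of_volume {a : Fin 3 → ℝ} (ha : ∀ i, 0 < a i) (hvol : a 0 * a 1 * a 2 = 1) :
    3 ≤ a 0 + a 1 + a 2 := by
  have p0 := ha 0
  have p1 := ha 1
  have p2 := ha 2
  have h : 27 * (a 0 * a 1 * a 2) ≤ (a 0 + a 1 + a 2) ^ 3 := by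
    nlinarith [mul_nonneg p0.le (sq_nonneg (a 1 - a 2)), mul_nonneg p1.le (sq_nonneg (a 0 - a 2)),
      mul_nonneg p2.le (sq_nonneg (a 0 - a 1)),
      mul_nonneg (add_pos (add_pos p0 p1) p2).le (add_nonneg (add_nonneg (sq_nonneg (a 0 - a 1))
        (sq_nonneg (a 1 - a 2))) (sq_nonneg (a 0 - a 2)))]
  by_contra hlt
  push Not at hlt
  have : (a 0 + a 1 + a 2) ^ 3 < 3 ^ 3 := by gcongr
  linarith

lemma energyPoly_one_le {a : Fin 3 → ℝ} (ha : ∀ i, 0 < a i) (hvol : a 0 * a 1 * a 2 = 1) :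
    energyPoly 1 ≤ energyPoly a := by
  have h := three_le_add_of_volume ha hvol
  simp only [energyPoly, Pi.one_apply]
  nlinarith [sq_nonneg (a 0 - a 1), sq_nonneg (a 1 - a 2), sq_nonneg (a 0 - a 2),
    sq_nonneg (a 0 + a 1 + a 2 - 3)]

/-! ### The nearly Kähler structure and the Killing spinor -/

lemma leviCivita_one {ν : ℝ} (hν : ν ≠ 0) (i : Fin 6) :
    leviCivita ν (diagForm 1) i = (-(ν / 2)) • bracketMat i := by
  rw [leviCivita_diagForm (a := 1) hν fun _ => one_pos]
  congr 1
  simp only [connFactor, Pi.one_apply, Real.sqrt_one]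
  ring

lemma sum_smul_bracketMat (x : Fin 6 → ℝ) : ∑ i, x i • bracketMat i = !![
    0, 0, x 4, -x 5, -x 2, x 3;
    0, 0, -x 5, -x 4, x 3, x 2;
    -x 4, x 5, 0, 0, x 0, -x 1;
    x 5, x 4, 0, 0, -x 1, -x 0;
    x 2, -x 3, -x 0, x 1, 0, 0;
    -x 3, -x 2, x 1, x 0, 0, 0] := by
  ext i j
  have e : (∑ i, x i • bracketMat i) i j = x 0 * bracketConst 0 i j + x 1 * bracketConst 1 i j +
      x 2 * bracketConst 2 i j + x 3 * bracketConst 3 i j + x 4 * bracketConst 4 i j +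
      x 5 * bracketConst 5 i j := by
    simp only [Matrix.sum_apply, Fin.sum_univ_six, bracketMat, Matrix.smul_apply, of_apply,
      smul_eq_mul]
  rw [e]
  fin_cases i <;> fin_cases j <;> simp [bracketConst]

lemma isStrictlyNearlyKahler_one {ν : ℝ} (hν : ν ≠ 0) :
    IsStrictlyNearlyKahler ν (diagForm 1) := by
  have h1 : ∀ i : Fin 3, 0 < (1 : Fin 3 → ℝ) i := fun _ => one_pos
  -- the almost complex structure acts as `-i` on each of the three summands
  have hJ : blockMul (fun _ => -Complex.I) = !![
      0, -1, 0, 0, 0, 0; 1, 0, 0, 0, 0, 0; 0, 0, 0, -1, 0, 0; 0, 0, 1, 0, 0, 0;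
      0, 0, 0, 0, 0, -1; 0, 0, 0, 0, 1, 0] := by
    simp [blockMul]
  have hJJ : blockMul (fun _ => -Complex.I) * blockMul (fun _ => -Complex.I) = -1 := by
    rw [blockMul_mul, ← neg_eq_iff_eq_neg, ← diagonal_one]
    ext i j
    fin_cases i <;> fin_cases j <;> simp [blockMul]
  -- the bracket is of type (3, 0), that is, complex antilinear in each argument
  have hanti : ∀ x : Fin 6 → ℝ, blockMul (fun _ => -Complex.I) * ∑ i, x i • bracketMat i =
      -((∑ i, x i • bracketMat i) * blockMul (fun _ => -Complex.I)) := by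
    intro x
    rw [sum_smul_bracketMat, hJ]
    simp
  have hcov : ∀ x, covDerivEnd ν (diagForm 1) (blockMul fun _ => -Complex.I) x =
      (-ν) • ((∑ i, x i • bracketMat i) * blockMul (fun _ => -Complex.I)) := by
    intro x
    have hs : ∑ i, x i • leviCivita ν (diagForm 1) i = (-(ν / 2)) • ∑ i, x i • bracketMat i := by
      rw [Finset.smul_sum]
      exact Finset.sum_congr rfl fun i _ => by rw [leviCivita_one hν, smul_comm]
    rw [covDerivEnd, hs, Matrix.smul_mul, Matrix.mul_smul, hanti]
    module
  refine ⟨blockMul fun _ => -Complex.I, ?_, ?_, ?_, ?_, ?_⟩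
  · exact hJJ
  · rw [blockMul_transpose, blockMul_mul]
    ext i j
    fin_cases i <;> fin_cases j <;> simp [blockMul]
  · intro t ht
    obtain ⟨d, rfl, -⟩ := mem_torus_iff.1 ht
    rw [isotropy_diagonal hν, frame_inv_mul_blockMul_mul_frame h1, blockMul_comm]
  · intro x
    rw [hcov, Matrix.smul_mulVec, ← Matrix.mulVec_mulVec, sum_smul_bracketMat, hJ]
    funext i
    fin_cases i <;> simp [dotProduct, Fin.sum_univ_six] <;> right <;> ring
  · intro x hx h0
    rw [hcov, smul_eq_zero] at h0
    have hB : ∑ i, x i • bracketMat i = 0 := by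
      have h := congrArg (· * blockMul fun _ => -Complex.I)
        (h0.resolve_left (neg_ne_zero.2 hν))
      simpa only [Matrix.mul_assoc, hJJ, Matrix.mul_neg, Matrix.mul_one, Matrix.zero_mul,
        neg_eq_zero] using h
    -- every coordinate of `x` is, up to sign, an entry of this matrix
    rw [sum_smul_bracketMat] at hB
    refine hx (funext fun i => ?_)
    have e0 := congrFun₂ hB 2 4
    have e1 := congrFun₂ hB 2 5
    have e2 := congrFun₂ hB 1 5
    have e3 := congrFun₂ hB 0 5
    have e4 := congrFun₂ hB 0 2
    have e5 := congrFun₂ hB 0 3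
    simp at e0 e1 e2 e3 e4 e5
    fin_cases i <;> simp [*]

/-- The spinor `(φ₁ + φ₂) / √2` is fixed by the exchange of `φ₁` and `φ₂`, which turns the formula
for the covariant derivative into the Killing equation. -/
lemma exists_killingSpinor {ν V : ℝ} (hν : ν ≠ 0) (hV : 0 < V) :
    ∃ (c : ℝ) (φ : Spinor), c ≠ 0 ∧ (diagForm 1, φ) ∈ unitSpinorsNormalized ν V ∧
      IsKillingSpinor ν (diagForm 1) c φ := by
  have h1 : ∀ i : Fin 3, 0 < (1 : Fin 3 → ℝ) i := fun _ => one_pos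
  have hc : ∀ c, connFactor ν 1 c = -(ν / 2) := by
    intro c
    simp only [connFactor, Pi.one_apply, Real.sqrt_one]
    ring
  refine ⟨-(ν / 2), ((√2)⁻¹ : ℂ) • phi1 + ((√2)⁻¹ : ℂ) • phi2, by simpa using hν, ⟨?_, ?_⟩, ?_⟩
  · refine (mem_unitSpinors_iff hν).2 ⟨h1, Submodule.mem_span_pair.2 ⟨_, _, rfl⟩, ?_⟩
    have hn : ‖((√2)⁻¹ : ℂ) • phi1 + ((√2)⁻¹ : ℂ) • phi2‖ ^ 2 = 1 := by
      rw [norm_phi_sq, norm_inv, Complex.norm_real, Real.norm_eq_abs, inv_pow, sq_abs,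
        Real.sq_sqrt (by norm_num)]
      norm_num
    exact (pow_eq_one_iff_of_nonneg (norm_nonneg _) (by norm_num)).1 hn
  · exact (volume_diagForm_eq_iff hV.ne' h1).2 (by simp)
  · intro i
    rw [covDeriv_diagForm hν h1, hc]

/-! ### Linearization -/

lemma linearization_apply (ν : ℝ) (x : Fin 3 → ℝ) : Matrix.toLin' (linearization ν) x =
    (4 * ν ^ 2 * (-(5 / 16))) • x + (4 * ν ^ 2 * (5 / 48) * (x 0 + x 1 + x 2)) • (1 : Fin 3 → ℝ)
    := by
  funext i
  fin_cases i <;>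
    simp [linearization, Matrix.mulVec, dotProduct, Fin.sum_univ_three] <;>
    ring

lemma hasFDerivAt_flowFieldNormalized (ν : ℝ) : HasFDerivAt (flowFieldNormalized ν)
    (LinearMap.toContinuousLinearMap (Matrix.toLin' (linearization ν))) 1 := by
  rw [hasFDerivAt_pi']
  intro c
  have hp : ∀ i : Fin 3, HasFDerivAt (fun a : Fin 3 → ℝ => a i)
      (ContinuousLinearMap.proj (R := ℝ) (φ := fun _ : Fin 3 => ℝ) i) 1 :=
    fun i => hasFDerivAt_apply i _
  have key : ∀ i j k : Fin 3, HasFDerivAt (fun a : Fin 3 → ℝ =>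
      4 * ν ^ 2 * ((1 / 48) * (-2 - 6 * (a i ^ 2 / (a j * a k)) + a i * (a j + a k) / (a j * a k)
        + 3 * ((a j ^ 2 + a k ^ 2) / (a j * a k)))))
      ((4 * ν ^ 2 * (1 / 48)) • ((-10 : ℝ) •
        ContinuousLinearMap.proj (R := ℝ) (φ := fun _ : Fin 3 => ℝ) i +
        (5 : ℝ) • ContinuousLinearMap.proj (R := ℝ) (φ := fun _ : Fin 3 => ℝ) j +
        (5 : ℝ) • ContinuousLinearMap.proj (R := ℝ) (φ := fun _ : Fin 3 => ℝ) k)) 1 := by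
    intro i j k
    have hjk := (hp j).fun_mul (hp k)
    have hne : (1 : Fin 3 → ℝ) j * (1 : Fin 3 → ℝ) k ≠ 0 := by simp
    have hinv := (hasDerivAt_inv hne).comp_hasFDerivAt (1 : Fin 3 → ℝ) hjk
    have h1 := ((hp i).pow 2).mul hinv
    have h2 := ((hp i).mul ((hp j).add (hp k))).mul hinv
    have h3 := (((hp j).pow 2).add ((hp k).pow 2)).mul hinv
    have h := ((((h1.const_mul 6).const_sub (-2)).add h2).add (h3.const_mul 3)).const_mul
      (1 / 48) |>.const_mul (4 * ν ^ 2)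
    refine (h.congr_fderiv ?_).congr_of_eventuallyEq (Filter.Eventually.of_forall fun a => ?_)
    · ext x
      simp
      ring
    · simp [div_eq_mul_inv]
  refine (key c (c + 1) (c + 2)).congr_fderiv ?_
  ext x
  simp only [ContinuousLinearMap.comp_apply, LinearMap.coe_toContinuousLinearMap',
    linearization_apply]
  fin_cases c <;> simp <;> ring

lemma linearization_apply_of_sum_eq_zero (ν : ℝ) {x : Fin 3 → ℝ} (hx : x 0 + x 1 + x 2 = 0) :
    Matrix.toLin' (linearization ν) x = (4 * ν ^ 2 * (-(5 / 16))) • x := by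
  rw [linearization_apply, hx, mul_zero, zero_smul, add_zero]

lemma linearization_apply_one (ν : ℝ) : Matrix.toLin' (linearization ν) 1 = 0 := by
  rw [linearization_apply]
  funext i
  simp
  ring

/-- The linearization is a multiple of the projection along the line of `(1, 1, 1)`. -/
lemma linearization_sq (ν : ℝ) (x : Fin 3 → ℝ) :
    Matrix.toLin' (linearization ν) (Matrix.toLin' (linearization ν) x) =
      (4 * ν ^ 2 * (-(5 / 16))) • Matrix.toLin' (linearization ν) x := by
  refine linearization_apply_of_sum_eq_zero ν ?_
  rw [linearization_apply]
  simp
  ring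

lemma mem_span_one_of_linearization_eq_zero {ν : ℝ} (hν : ν ≠ 0) {x : Fin 3 → ℝ}
    (h : Matrix.toLin' (linearization ν) x = 0) : x ∈ Submodule.span ℝ {(1 : Fin 3 → ℝ)} := by
  rw [Submodule.mem_span_singleton]
  refine ⟨(x 0 + x 1 + x 2) / 3, ?_⟩
  rw [linearization_apply] at h
  funext i
  have hi := congrFun h i
  have hν2 : ν ^ 2 ≠ 0 := pow_ne_zero 2 hν
  simp only [Pi.add_apply, Pi.smul_apply, Pi.one_apply, smul_eq_mul, Pi.zero_apply, mul_one]
    at hi ⊢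
  refine mul_left_cancel₀ hν2 ?_
  linear_combination (4 / 5) * hi

lemma hasEigenvalue_linearization_iff {ν : ℝ} (μ : ℝ) :
    Module.End.HasEigenvalue (Matrix.toLin' (linearization ν)) μ ↔
      μ = 0 ∨ μ = 4 * ν ^ 2 * (-(5 / 16)) := by
  constructor
  · intro h
    obtain ⟨x, hx⟩ := h.exists_hasEigenvector
    have e := linearization_sq ν x
    rw [hx.apply_eq_smul, map_smul, hx.apply_eq_smul, smul_smul, smul_smul, ← sub_eq_zero,
      ← sub_smul, smul_eq_zero] at e
    have := e.resolve_right hx.2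
    rw [← sub_mul, mul_eq_zero, sub_eq_zero] at this
    exact this.symm
  · have hev : ∀ (μ : ℝ) (x : Fin 3 → ℝ), x ≠ 0 → Matrix.toLin' (linearization ν) x = μ • x →
        Module.End.HasEigenvalue (Matrix.toLin' (linearization ν)) μ := fun μ x hx h =>
      Module.End.hasEigenvalue_of_hasEigenvector
        ⟨Module.End.mem_eigenspace_iff.2 h, hx⟩
    rintro (rfl | rfl)
    · exact hev 0 1 one_ne_zero (by rw [linearization_apply_one, zero_smul])
    · refine hev _ ![1, -1, 0] (fun h => one_ne_zero (congrFun h 0)) ?_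
      exact linearization_apply_of_sum_eq_zero ν (by simp)

lemma maxGenEigenspace_linearization {ν : ℝ} (hν : ν ≠ 0) :
    Module.End.maxGenEigenspace (Matrix.toLin' (linearization ν)) 0 =
      Submodule.span ℝ {(1 : Fin 3 → ℝ)} := by
  apply le_antisymm
  · intro x hx
    rw [Module.End.mem_maxGenEigenspace] at hx
    obtain ⟨k, hk⟩ := hx
    rw [zero_smul, sub_zero] at hk
    induction k with
    | zero =>
      rw [pow_zero, Module.End.one_apply] at hk
      rw [hk]
      exact Submodule.zero_mem _
    | succ k ih =>
      rcases k.eq_zero_or_pos with rfl | hpos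
      · rw [zero_add, pow_one] at hk
        exact mem_span_one_of_linearization_eq_zero hν hk
      · refine ih ?_
        obtain ⟨m, rfl⟩ := Nat.exists_eq_succ_of_ne_zero hpos.ne'
        rw [pow_succ, pow_succ, Module.End.mul_apply, Module.End.mul_apply, linearization_sq,
          map_smul, smul_eq_zero] at hk
        rw [pow_succ, Module.End.mul_apply]
        refine hk.resolve_left ?_
        simpa using hν
  · rw [Submodule.span_singleton_le_iff_mem, Module.End.mem_maxGenEigenspace]
    refine ⟨1, ?_⟩
    rw [zero_smul, sub_zero, pow_one, linearization_apply_one]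

/-! ### Ordinary differential equations on a half-line -/

section HalfLine

/-- A bounded Lipschitz vector field has integral curves on `[0, ∞)`: the Picard-Lindelöf theorem
applies on every compact interval, and the solutions agree where they are both defined. -/
lemma exists_solution_Ici_of_lipschitz_of_bounded {X : Type*} [NormedAddCommGroup X]
    [NormedSpace ℝ X] [CompleteSpace X] {f : X → X} {K L : NNReal} (hf : LipschitzWith K f)
    (hL : ∀ x, ‖f x‖ ≤ L) (x₀ : X) :
    ∃ α : ℝ → X, α 0 = x₀ ∧ ∀ t ∈ Set.Ici (0 : ℝ), HasDerivWithinAt α (f (α t)) (Set.Ici 0) t := by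
  have hex : ∀ n : ℕ, ∃ α : ℝ → X, α 0 = x₀ ∧
      ∀ t ∈ Set.Icc (0 : ℝ) n, HasDerivWithinAt α (f (α t)) (Set.Icc 0 n) t := by
    intro n
    have hpl : IsPicardLindelof (fun _ => f) (⟨0, by simp⟩ : Set.Icc (0 : ℝ) n) x₀ (L * n) 0 L K :=
      .of_time_independent (fun x _ => hL x) hf.lipschitzOnWith (by simp)
    exact hpl.exists_eq_forall_mem_Icc_hasDerivWithinAt₀
  choose α hα0 hα using hex
  have hright : ∀ n : ℕ, ∀ t ∈ Set.Ico (0 : ℝ) n,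
      HasDerivWithinAt (α n) (f (α n t)) (Set.Ici t) t := by
    intro n t ht
    refine (hα n t ⟨ht.1, ht.2.le⟩).mono_of_mem_nhdsWithin ?_
    exact mem_of_superset (Icc_mem_nhdsGE ht.2) (Set.Icc_subset_Icc_left ht.1)
  have hagree : ∀ n m : ℕ, n ≤ m → Set.EqOn (α n) (α m) (Set.Icc 0 n) := by
    intro n m hnm
    have hnm' : (n : ℝ) ≤ m := Nat.cast_le.2 hnm
    refine ODE_solution_unique (v := fun _ => f) (fun _ => hf)
      (fun t ht => (hα n t ht).continuousWithinAt) (hright n)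
      (fun t ht => ?_) (fun t ht => hright m t ⟨ht.1, ht.2.trans_le hnm'⟩)
      ((hα0 n).trans (hα0 m).symm)
    exact (hα m t ⟨ht.1, ht.2.trans hnm'⟩).continuousWithinAt.mono
      (Set.Icc_subset_Icc_right hnm')
  refine ⟨fun t => α (⌊t⌋₊ + 1) t, by simpa using hα0 1, fun t ht => ?_⟩
  have ht0 : (0 : ℝ) ≤ t := ht
  -- near `t` the curve coincides with the solution on `[0, N]`
  set N := ⌊t⌋₊ + 2 with hN
  have htN : t < N := by
    have := Nat.lt_floor_add_one t
    rw [hN]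
    push_cast
    linarith
  have heq : ∀ s : ℝ, 0 ≤ s → s < N → α (⌊s⌋₊ + 1) s = α N s := by
    intro s hs hsN
    refine hagree _ _ ?_ ⟨hs, ?_⟩
    · exact (Nat.floor_lt hs).2 hsN
    · push_cast
      exact (Nat.lt_floor_add_one s).le
  have hmem : Set.Icc (0 : ℝ) N ∈ 𝓝[Set.Ici 0] t := by
    rw [← Set.Ici_inter_Iic]
    exact inter_mem self_mem_nhdsWithin (mem_nhdsWithin_of_mem_nhds (Iic_mem_nhds htN))
  have hd := (hα N t ⟨ht0, htN.le⟩).mono_of_mem_nhdsWithin hmem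
  simp only
  rw [heq t ht0 htN]
  refine hd.congr_of_eventuallyEq ?_ (heq t ht0 htN)
  filter_upwards [self_mem_nhdsWithin, mem_nhdsWithin_of_mem_nhds (Iio_mem_nhds htN)] with s hs hsN
  exact heq s hs hsN

/-- A function on `[0, ∞)` that starts below `M` and does not increase while it is above `M` stays
below `M`. -/
lemma le_of_deriv_nonpos_above {f f' : ℝ → ℝ} {M : ℝ}
    (hf : ∀ t ∈ Set.Ici (0 : ℝ), HasDerivWithinAt f (f' t) (Set.Ici 0) t) (h0 : f 0 ≤ M)
    (hM : ∀ t ∈ Set.Ici (0 : ℝ), M < f t → f' t ≤ 0) : ∀ t ∈ Set.Ici (0 : ℝ), f t ≤ M := by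
  intro t ht
  have ht0 : (0 : ℝ) ≤ t := ht
  refine le_of_forall_pos_le_add fun δ hδ => ?_
  -- compare with an increasing affine function that lies above `M`
  set ε := δ / (1 + t) with hε
  have hεpos : 0 < ε := by positivity
  have hB : ∀ s : ℝ, HasDerivAt (fun s => M + ε * (1 + s)) ε s := by
    intro s
    simpa using (((hasDerivAt_id s).const_add 1).const_mul ε).const_add M
  have key := image_le_of_deriv_right_lt_deriv_boundary' (a := 0) (b := t) (f := f) (f' := f')
    (B := fun s => M + ε * (1 + s)) (B' := fun _ => ε)
    (fun s hs => (hf s hs.1).continuousWithinAt.mono Set.Icc_subset_Ici_self)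
    (fun s hs => (hf s hs.1).mono (Set.Ici_subset_Ici.2 hs.1))
    (by linarith) (fun s _ => (hB s).continuousAt.continuousWithinAt)
    (fun s _ => (hB s).hasDerivWithinAt)
    (fun s hs hfs => (hM s hs.1 (by rw [hfs]; nlinarith [hs.1])).trans_lt hεpos)
    ⟨ht0, le_rfl⟩
  have : ε * (1 + t) = δ := by
    rw [hε]
    field_simp
  linarith

end HalfLine

/-! ### Long-time existence of the normalized flow -/

lemma flowFieldNormalized_nonpos_of_max (ν : ℝ) {a : Fin 3 → ℝ} (ha : ∀ i, 0 < a i) {i : Fin 3}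
    (hi : ∀ j, a j ≤ a i) : flowFieldNormalized ν a i ≤ 0 := by
  have hy := ha (i + 1)
  have hz := ha (i + 2)
  have hyx := hi (i + 1)
  have hzx := hi (i + 2)
  have e : flowFieldNormalized ν a i = -(ν ^ 2 / 12 / (a (i + 1) * a (i + 2)) *
      (2 * ((a i - a (i + 1)) * (a i - a (i + 2))) + 2 * (a i * (a i - a (i + 1)))
        + 2 * (a i * (a i - a (i + 2))) + 3 * (a (i + 1) * (a i - a (i + 1)))
        + 3 * (a (i + 2) * (a i - a (i + 2))))) := by
    rw [flowFieldNormalized]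
    field_simp
    ring
  have p1 := mul_nonneg (sub_nonneg.2 hyx) (sub_nonneg.2 hzx)
  have p2 := mul_nonneg (ha i).le (sub_nonneg.2 hyx)
  have p3 := mul_nonneg (ha i).le (sub_nonneg.2 hzx)
  have p4 := mul_nonneg hy.le (sub_nonneg.2 hyx)
  have p5 := mul_nonneg hz.le (sub_nonneg.2 hzx)
  rw [e, neg_nonpos]
  positivity

lemma flowFieldNormalized_nonneg_of_min (ν : ℝ) {a : Fin 3 → ℝ} (ha : ∀ i, 0 < a i) {i : Fin 3}
    (hi : ∀ j, a i ≤ a j) : 0 ≤ flowFieldNormalized ν a i := by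
  have hy := ha (i + 1)
  have hz := ha (i + 2)
  have hxy := hi (i + 1)
  have hxz := hi (i + 2)
  have e : flowFieldNormalized ν a i = ν ^ 2 / 12 / (a (i + 1) * a (i + 2)) *
      ((a (i + 1) - a (i + 2)) ^ 2 + 2 * (a (i + 1) * (a (i + 1) - a i))
        + 2 * (a (i + 2) * (a (i + 2) - a i)) + 3 * (a i * (a (i + 1) - a i))
        + 3 * (a i * (a (i + 2) - a i))) := by
    rw [flowFieldNormalized]
    field_simp
    ring
  have p1 := mul_nonneg hy.le (sub_nonneg.2 hxy)
  have p2 := mul_nonneg hz.le (sub_nonneg.2 hxz)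
  have p3 := mul_nonneg (ha i).le (sub_nonneg.2 hxy)
  have p4 := mul_nonneg (ha i).le (sub_nonneg.2 hxz)
  rw [e]
  positivity

/-- The nearest point of the cube `[m, M]³`. -/
def clamp (m M : ℝ) (a : Fin 3 → ℝ) : Fin 3 → ℝ := fun i => max m (min M (a i))

lemma clamp_mem {m M : ℝ} (hmM : m ≤ M) (a : Fin 3 → ℝ) :
    clamp m M a ∈ Set.Icc (fun _ => m) (fun _ => M) :=
  ⟨fun _ => le_max_left _ _, fun _ => max_le hmM (min_le_left _ _)⟩

lemma lipschitzWith_clamp (m M : ℝ) : LipschitzWith 1 (clamp m M) := by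
  refine LipschitzWith.of_dist_le_mul fun a b => ?_
  rw [NNReal.coe_one, one_mul, dist_pi_le_iff dist_nonneg]
  intro i
  have h := ((LipschitzWith.id (α := ℝ)).const_min M).const_max m
  refine (h.dist_le_mul (a i) (b i)).trans ?_
  rw [NNReal.coe_one, one_mul]
  exact dist_le_pi_dist a b i

lemma contDiffOn_flowFieldNormalized (ν : ℝ) {m M : ℝ} (hm : 0 < m) :
    ContDiffOn ℝ 1 (flowFieldNormalized ν) (Set.Icc (fun _ => m) (fun _ => M)) := by
  rw [contDiffOn_pi]
  intro i
  have hp : ∀ j : Fin 3, ContDiffOn ℝ 1 (fun a : Fin 3 → ℝ => a j)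
      (Set.Icc (fun _ => m) (fun _ => M)) := fun j => (contDiff_apply ℝ ℝ j).contDiffOn
  have hne : ∀ a ∈ Set.Icc (fun _ : Fin 3 => m) (fun _ => M), a (i + 1) * a (i + 2) ≠ 0 := by
    intro a ha
    exact (mul_pos (hm.trans_le (ha.1 _)) (hm.trans_le (ha.1 _))).ne'
  have hjk := (hp (i + 1)).mul (hp (i + 2))
  have h1 := ((hp i).pow 2).div hjk hne
  have h2 := ((hp i).mul ((hp (i + 1)).add (hp (i + 2)))).div hjk hne
  have h3 := (((hp (i + 1)).pow 2).add ((hp (i + 2)).pow 2)).div hjk hne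
  exact contDiffOn_const.mul (contDiffOn_const.mul
    (((contDiffOn_const.sub (contDiffOn_const.mul h1)).add h2).add (contDiffOn_const.mul h3)))

lemma exists_lipschitzOnWith_flowFieldNormalized (ν : ℝ) {m M : ℝ} (hm : 0 < m) :
    ∃ K, LipschitzOnWith K (flowFieldNormalized ν) (Set.Icc (fun _ => m) (fun _ => M)) :=
  LocallyLipschitzOn.exists_lipschitzOnWith_of_compact isCompact_Icc
    ((contDiffOn_flowFieldNormalized ν hm).locallyLipschitzOn (convex_Icc _ _))

/-- The normalized field is tangent to the level sets of the volume. -/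
lemma flowFieldNormalized_tangent (ν : ℝ) {a : Fin 3 → ℝ} (ha : ∀ i, 0 < a i) :
    (flowFieldNormalized ν a 0 * a 1 + a 0 * flowFieldNormalized ν a 1) * a 2 +
      a 0 * a 1 * flowFieldNormalized ν a 2 = 0 := by
  have p0 := ha 0
  have p1 := ha 1
  have p2 := ha 2
  rw [flowFieldNormalized_zero, flowFieldNormalized_one, flowFieldNormalized_two]
  field_simp
  ring

/-- The cube spanned by the smallest and the largest initial parameter is invariant under the
normalized equations, which gives a solution for all times. -/
lemma exists_solution_flowFieldNormalized (ν : ℝ) {a₀ : Fin 3 → ℝ} (ha₀ : ∀ i, 0 < a₀ i)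
    (hvol : a₀ 0 * a₀ 1 * a₀ 2 = 1) : ∃ a : ℝ → Fin 3 → ℝ, a 0 = a₀ ∧
      ∀ t ∈ Set.Ici (0 : ℝ), (∀ i, 0 < a t i) ∧ a t 0 * a t 1 * a t 2 = 1 ∧
        HasDerivWithinAt a (flowFieldNormalized ν (a t)) (Set.Ici 0) t := by
  obtain ⟨m, M, hm, hmM, hbox⟩ : ∃ m M : ℝ, 0 < m ∧ m ≤ M ∧ ∀ i, m ≤ a₀ i ∧ a₀ i ≤ M := by
    refine ⟨min (a₀ 0) (min (a₀ 1) (a₀ 2)), max (a₀ 0) (max (a₀ 1) (a₀ 2)), ?_, ?_, ?_⟩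
    · exact lt_min (ha₀ 0) (lt_min (ha₀ 1) (ha₀ 2))
    · exact (min_le_left _ _).trans (le_max_left _ _)
    · intro i
      fin_cases i <;> simp
  -- solve the equation for the field that is frozen outside the cube
  obtain ⟨K, hK⟩ := exists_lipschitzOnWith_flowFieldNormalized (M := M) ν hm
  have hlip : LipschitzWith (K * 1) (flowFieldNormalized ν ∘ clamp m M) :=
    lipschitzOnWith_univ.1
      (hK.comp ((lipschitzWith_clamp m M).lipschitzOnWith (s := Set.univ))
        fun a _ => clamp_mem hmM a)
  obtain ⟨L, hL⟩ := isCompact_Icc.exists_bound_of_continuousOn hK.continuousOn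
  have hbd : ∀ x, ‖(flowFieldNormalized ν ∘ clamp m M) x‖ ≤ (Real.toNNReal L : ℝ) := fun x =>
    (hL _ (clamp_mem hmM x)).trans (Real.le_coe_toNNReal L)
  obtain ⟨a, h0, hsol⟩ := exists_solution_Ici_of_lipschitz_of_bounded hlip hbd a₀
  have hcoord : ∀ i, ∀ t ∈ Set.Ici (0 : ℝ), HasDerivWithinAt (fun s => a s i)
      (flowFieldNormalized ν (clamp m M (a t)) i) (Set.Ici 0) t := fun i t ht =>
    hasDerivWithinAt_pi.1 (hsol t ht) i
  have hcpos : ∀ t i, 0 < clamp m M (a t) i := fun t i => hm.trans_le (le_max_left _ _)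
  -- the cube is invariant, since the field points inwards on its faces
  have hup : ∀ i, ∀ t ∈ Set.Ici (0 : ℝ), a t i ≤ M := by
    intro i
    refine le_of_deriv_nonpos_above (hcoord i) (by rw [h0]; exact (hbox i).2) fun t _ hlt => ?_
    refine flowFieldNormalized_nonpos_of_max ν (hcpos t) fun j => ?_
    have : clamp m M (a t) i = M := by
      rw [clamp, min_eq_left hlt.le, max_eq_right hmM]
    rw [this]
    exact (clamp_mem hmM (a t)).2 j
  have hlow : ∀ i, ∀ t ∈ Set.Ici (0 : ℝ), m ≤ a t i := by
    intro i t ht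
    refine neg_le_neg_iff.1 (le_of_deriv_nonpos_above (f := fun s => -a s i)
      (fun s hs => (hcoord i s hs).neg) ?_ (fun s _ hlt => ?_) t ht)
    · rw [h0]
      exact neg_le_neg (hbox i).1
    · rw [neg_nonpos]
      refine flowFieldNormalized_nonneg_of_min ν (hcpos s) fun j => ?_
      have : clamp m M (a s) i = m := by
        rw [clamp, max_eq_left ((min_le_right _ _).trans (neg_lt_neg_iff.1 hlt).le)]
      rw [this]
      exact (clamp_mem hmM (a s)).1 j
  have hclamp : ∀ t ∈ Set.Ici (0 : ℝ), clamp m M (a t) = a t := by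
    intro t ht
    funext i
    rw [clamp, min_eq_right (hup i t ht), max_eq_right (hlow i t ht)]
  have hpos : ∀ t ∈ Set.Ici (0 : ℝ), ∀ i, 0 < a t i := fun t ht i => hm.trans_le (hlow i t ht)
  have hprod : ∀ t ∈ Set.Ici (0 : ℝ), HasDerivWithinAt (fun s => a s 0 * a s 1 * a s 2) 0
      (Set.Ici 0) t := by
    intro t ht
    have h := ((hcoord 0 t ht).mul (hcoord 1 t ht)).mul (hcoord 2 t ht)
    rw [hclamp t ht] at h
    exact h.congr_deriv (flowFieldNormalized_tangent ν (hpos t ht))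
  refine ⟨a, h0, fun t ht => ⟨hpos t ht, ?_, ?_⟩⟩
  · have := Convex.norm_image_sub_le_of_norm_hasDerivWithin_le (C := 0) hprod (by simp)
      (convex_Ici 0) (Set.self_mem_Ici) ht
    rw [zero_mul, norm_le_zero_iff, sub_eq_zero] at this
    rw [this, h0, hvol]
  · have h := hsol t ht
    rwa [Function.comp_apply, hclamp t ht] at h

/-! ### Convergence and uniqueness of the normalized flow -/

/-- A solution of the normalized equations on `D`. -/
def IsSolution (ν : ℝ) (D : Set ℝ) (a : ℝ → Fin 3 → ℝ) : Prop :=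
  ∀ t ∈ D, (∀ i, 0 < a t i) ∧ a t 0 * a t 1 * a t 2 = 1 ∧
    HasDerivWithinAt a (flowFieldNormalized ν (a t)) D t

lemma IsSolution.hasDerivWithinAt_sum {ν : ℝ} {D : Set ℝ} {a : ℝ → Fin 3 → ℝ}
    (h : IsSolution ν D a) {t : ℝ} (ht : t ∈ D) :
    HasDerivWithinAt (fun s => a s 0 + a s 1 + a s 2) (flowFieldNormalized ν (a t) 0 +
      flowFieldNormalized ν (a t) 1 + flowFieldNormalized ν (a t) 2) D t := by
  have hc := hasDerivWithinAt_pi.1 (h t ht).2.2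
  exact ((hc 0).add (hc 1)).add (hc 2)

lemma IsSolution.sum_deriv_le {ν : ℝ} {D : Set ℝ} {a : ℝ → Fin 3 → ℝ} (h : IsSolution ν D a)
    {t : ℝ} (ht : t ∈ D) : flowFieldNormalized ν (a t) 0 + flowFieldNormalized ν (a t) 1 +
      flowFieldNormalized ν (a t) 2 ≤ -(ν ^ 2 / 6 * spread (a t)) := by
  have hle := sum_flowFieldNormalized_mul_le ν (h t ht).1
  rwa [(h t ht).2.1, mul_one] at hle

lemma spread_nonneg {a : Fin 3 → ℝ} (ha : ∀ i, 0 < a i) : 0 ≤ spread a := by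
  have p0 := ha 0
  have p1 := ha 1
  have p2 := ha 2
  rw [spread]
  positivity

lemma IsSolution.antitoneOn_sum {ν : ℝ} {D : Set ℝ} (hD : Convex ℝ D) {a : ℝ → Fin 3 → ℝ}
    (h : IsSolution ν D a) : AntitoneOn (fun s => a s 0 + a s 1 + a s 2) D := by
  refine antitoneOn_of_hasDerivWithinAt_nonpos hD
    (fun t ht => (h.hasDerivWithinAt_sum ht).continuousWithinAt)
    (fun t ht => (h.hasDerivWithinAt_sum (interior_subset ht)).mono interior_subset)
    fun t ht => ?_
  refine (h.sum_deriv_le (interior_subset ht)).trans (neg_nonpos.2 ?_)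
  exact mul_nonneg (by positivity) (spread_nonneg (h t (interior_subset ht)).1)

/-- On the surface of volume one, a bound for the sum of the parameters bounds each of them from
above and away from zero. -/
lemma mem_Icc_of_sum_le {a : Fin 3 → ℝ} (ha : ∀ i, 0 < a i) (hvol : a 0 * a 1 * a 2 = 1) {s : ℝ}
    (hs : a 0 + a 1 + a 2 ≤ s) : a ∈ Set.Icc (fun _ : Fin 3 => (s ^ 2)⁻¹) (fun _ => s) := by
  have p0 := ha 0
  have p1 := ha 1
  have p2 := ha 2
  have hspos : 0 < s := by linarith
  have hlow : ∀ x y z : ℝ, 0 < x → 0 < y → 0 < z → x * y * z = 1 → y ≤ s → z ≤ s →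
      (s ^ 2)⁻¹ ≤ x := by
    intro x y z hx hy hz h hys hzs
    rw [inv_le_iff_one_le_mul₀ (by positivity), ← h, mul_assoc]
    have : y * z ≤ s ^ 2 := by
      rw [sq]
      gcongr
    gcongr
  have h1 : a 1 * a 0 * a 2 = 1 := by rw [← hvol]; ring
  have h2 : a 2 * a 0 * a 1 = 1 := by rw [← hvol]; ring
  constructor <;> intro i
  · fin_cases i
    · exact hlow _ _ _ p0 p1 p2 hvol (by linarith) (by linarith)
    · exact hlow _ _ _ p1 p0 p2 h1 (by linarith) (by linarith)
    · exact hlow _ _ _ p2 p0 p1 h2 (by linarith) (by linarith)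
  · fin_cases i
    · exact (show a 0 ≤ s by linarith)
    · exact (show a 1 ≤ s by linarith)
    · exact (show a 2 ≤ s by linarith)

/-- Both solutions stay in the cube determined by the initial sum of the parameters, on which the
field is Lipschitz. -/
lemma IsSolution.eqOn {ν b : ℝ} {a a' : ℝ → Fin 3 → ℝ} (h : IsSolution ν (Set.Ico 0 b) a)
    (h' : IsSolution ν (Set.Ico 0 b) a') (h0 : a 0 = a' 0) : Set.EqOn a a' (Set.Ico 0 b) := by
  intro t ht
  have hsub : Set.Icc 0 t ⊆ Set.Ico 0 b := Set.Icc_subset_Ico_right ht.2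
  have h0mem : (0 : ℝ) ∈ Set.Ico 0 b := ⟨le_rfl, ht.1.trans_lt ht.2⟩
  set s := a 0 0 + a 0 1 + a 0 2 with hs
  have hspos : 0 < s := by
    have := (h 0 h0mem).1
    linarith [this 0, this 1, this 2]
  obtain ⟨K, hK⟩ := exists_lipschitzOnWith_flowFieldNormalized (M := s) ν
    (inv_pos.2 (pow_pos hspos 2))
  have hcont : ∀ c, IsSolution ν (Set.Ico 0 b) c → ContinuousOn c (Set.Icc 0 t) := fun c hc r hr =>
    (hc r (hsub hr)).2.2.continuousWithinAt.mono hsub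
  have hder : ∀ c, IsSolution ν (Set.Ico 0 b) c → ∀ r ∈ Set.Ico 0 t,
      HasDerivWithinAt c (flowFieldNormalized ν (c r)) (Set.Ici r) r := by
    intro c hc r hr
    refine (hc r (hsub ⟨hr.1, hr.2.le⟩)).2.2.mono_of_mem_nhdsWithin ?_
    exact mem_of_superset (Ico_mem_nhdsGE (hr.2.trans ht.2)) (Set.Ico_subset_Ico_left hr.1)
  have hbox : ∀ c, IsSolution ν (Set.Ico 0 b) c → c 0 = a 0 → ∀ r ∈ Set.Ico 0 t,
      c r ∈ Set.Icc (fun _ : Fin 3 => (s ^ 2)⁻¹) (fun _ => s) := by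
    intro c hc hc0 r hr
    have hr' := hsub ⟨hr.1, hr.2.le⟩
    refine mem_Icc_of_sum_le (hc r hr').1 (hc r hr').2.1 ?_
    have := hc.antitoneOn_sum (convex_Ico 0 b) h0mem hr' hr.1
    simp only [hc0] at this
    exact this
  exact ODE_solution_unique_of_mem_Icc_right (v := fun _ => flowFieldNormalized ν)
    (s := fun _ => Set.Icc (fun _ : Fin 3 => (s ^ 2)⁻¹) (fun _ => s)) (fun _ _ => hK)
    (hcont a h) (hder a h) (hbox a h rfl) (hcont a' h') (hder a' h') (hbox a' h' h0.symm) h0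
    ⟨ht.1, le_rfl⟩

/-- Near its minimum `3` the sum of the parameters is comparable with `spread`. -/
lemma sum_sub_three_le_spread {a : Fin 3 → ℝ} (ha : ∀ i, 0 < a i) (hvol : a 0 * a 1 * a 2 = 1)
    {m : ℝ} (hm : 0 < m) (hma : ∀ i, m ≤ a i) :
    12 / 7 * m * (a 0 + a 1 + a 2 - 3) ≤ spread a := by
  have p0 := ha 0
  have p1 := ha 1
  have p2 := ha 2
  have h3 := three_le_add_of_volume ha hvol
  set S := a 0 + a 1 + a 2 with hS
  set D := (a 0 - a 1) ^ 2 + (a 1 - a 2) ^ 2 + (a 0 - a 2) ^ 2 with hD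
  have hD0 : 0 ≤ D := by positivity
  have hspread : 2 * m * D ≤ spread a := by
    rw [spread, hD]
    have e : 2 * m * ((a 0 - a 1) ^ 2 + (a 1 - a 2) ^ 2 + (a 0 - a 2) ^ 2) =
        (m + m) * (a 0 - a 1) ^ 2 + (m + m) * (a 1 - a 2) ^ 2 + (m + m) * (a 0 - a 2) ^ 2 := by
      ring
    rw [e]
    gcongr <;> exact hma _
  -- the identity behind the inequality of the arithmetic and geometric means
  have hcube : S ^ 3 - 27 = S / 2 * D + 3 * (a 2 * (a 0 - a 1) ^ 2 + a 0 * (a 1 - a 2) ^ 2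
      + a 1 * (a 0 - a 2) ^ 2) := by
    rw [hS, hD]
    linear_combination 27 * hvol
  have hcube' : S ^ 3 - 27 ≤ 7 / 2 * S * D := by
    have : a 2 * (a 0 - a 1) ^ 2 + a 0 * (a 1 - a 2) ^ 2 + a 1 * (a 0 - a 2) ^ 2 ≤ S * D := by
      rw [hD, mul_add, mul_add]
      gcongr <;> linarith
    linarith
  have hlin : 6 * (S - 3) ≤ 7 * D := by
    have e : S ^ 3 - 27 = (S - 3) * (S ^ 2 + 3 * S + 9) := by ring
    rw [e] at hcube'
    have h1 : (S - 3) * (S * 3) ≤ (S - 3) * (S ^ 2 + 3 * S + 9) := by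
      refine mul_le_mul_of_nonneg_left ?_ (by linarith)
      nlinarith
    have h2 : S * (6 * (S - 3)) ≤ S * (7 * D) := by linarith
    exact le_of_mul_le_mul_left h2 (by linarith)
  have : m * (6 * (S - 3)) ≤ m * (7 * D) := mul_le_mul_of_nonneg_left hlin hm.le
  linarith

/-- Near its minimum `3` the sum of the parameters controls the distance to `(1, 1, 1)`. -/
lemma sub_one_sq_le {a : Fin 3 → ℝ} (ha : ∀ i, 0 < a i) (hvol : a 0 * a 1 * a 2 = 1)
    (h4 : a 0 + a 1 + a 2 ≤ 4) (i : Fin 3) : (a i - 1) ^ 2 ≤ 41 * (a 0 + a 1 + a 2 - 3) := by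
  have p0 := ha 0
  have p1 := ha 1
  have p2 := ha 2
  have h3 := three_le_add_of_volume ha hvol
  set S := a 0 + a 1 + a 2 with hS
  set D := (a 0 - a 1) ^ 2 + (a 1 - a 2) ^ 2 + (a 0 - a 2) ^ 2 with hD
  have hcube : S / 2 * D ≤ S ^ 3 - 27 := by
    have e : S ^ 3 - 27 = S / 2 * D + 3 * (a 2 * (a 0 - a 1) ^ 2 + a 0 * (a 1 - a 2) ^ 2
        + a 1 * (a 0 - a 2) ^ 2) := by
      rw [hS, hD]
      linear_combination 27 * hvol
    have : 0 ≤ a 2 * (a 0 - a 1) ^ 2 + a 0 * (a 1 - a 2) ^ 2 + a 1 * (a 0 - a 2) ^ 2 := by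
      positivity
    linarith
  have hD20 : D ≤ 20 * (S - 3) := by
    have e : S ^ 3 - 27 = (S - 3) * (S ^ 2 + 3 * S + 9) := by ring
    have h1 : (S - 3) * (S ^ 2 + 3 * S + 9) ≤ (S - 3) * (10 * S) := by
      refine mul_le_mul_of_nonneg_left ?_ (by linarith)
      nlinarith
    have h2 : S * D ≤ S * (20 * (S - 3)) := by linarith
    exact le_of_mul_le_mul_left h2 (by linarith)
  have hmean : (a i - S / 3) ^ 2 ≤ D := by
    fin_cases i <;> simp only [Fin.zero_eta, Fin.mk_one, Fin.reduceFinMk, hS, hD] <;>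
      nlinarith [sq_nonneg (a 0 - a 1), sq_nonneg (a 1 - a 2), sq_nonneg (a 0 - a 2),
        sq_nonneg (a 0 + a 1 - 2 * a 2), sq_nonneg (a 0 + a 2 - 2 * a 1),
        sq_nonneg (a 1 + a 2 - 2 * a 0)]
  have hsq : (S - 3) ^ 2 ≤ S - 3 := by nlinarith
  nlinarith [sq_nonneg (a i - S / 3 - (S / 3 - 1))]

/-- The sum of the parameters converges to its minimum at an exponential rate. -/
lemma IsSolution.sum_sub_three_le {ν : ℝ} {a : ℝ → Fin 3 → ℝ} (hν : ν ≠ 0)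
    (h : IsSolution ν (Set.Ici 0) a) : ∃ c > 0, ∀ t, 0 ≤ t →
      a t 0 + a t 1 + a t 2 - 3 ≤ (a 0 0 + a 0 1 + a 0 2 - 3) * Real.exp (-(c * t)) := by
  set s := a 0 0 + a 0 1 + a 0 2 with hs
  have h0 := h 0 Set.self_mem_Ici
  have hspos : 0 < s := by linarith [h0.1 0, h0.1 1, h0.1 2]
  have hmpos : 0 < (s ^ 2)⁻¹ := inv_pos.2 (pow_pos hspos 2)
  refine ⟨ν ^ 2 / 6 * (12 / 7 * (s ^ 2)⁻¹), by positivity, fun t ht => ?_⟩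
  set c := ν ^ 2 / 6 * (12 / 7 * (s ^ 2)⁻¹) with hc
  have hexp : ∀ r : ℝ, HasDerivAt (fun r => Real.exp (c * r)) (Real.exp (c * r) * c) r := by
    intro r
    simpa using ((hasDerivAt_id r).const_mul c).exp
  have hanti : AntitoneOn (fun r => (a r 0 + a r 1 + a r 2 - 3) * Real.exp (c * r))
      (Set.Ici 0) := by
    have hd : ∀ r ∈ Set.Ici (0 : ℝ), HasDerivWithinAt
        (fun r => (a r 0 + a r 1 + a r 2 - 3) * Real.exp (c * r))
        ((flowFieldNormalized ν (a r) 0 + flowFieldNormalized ν (a r) 1 +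
          flowFieldNormalized ν (a r) 2) * Real.exp (c * r) +
          (a r 0 + a r 1 + a r 2 - 3) * (Real.exp (c * r) * c)) (Set.Ici 0) r := fun r hr =>
      ((h.hasDerivWithinAt_sum hr).sub_const 3).mul (hexp r).hasDerivWithinAt
    refine antitoneOn_of_hasDerivWithinAt_nonpos (convex_Ici 0)
      (fun r hr => (hd r hr).continuousWithinAt)
      (fun r hr => (hd r (interior_subset hr)).mono interior_subset) fun r hr => ?_
    have hr' : r ∈ Set.Ici (0 : ℝ) := interior_subset hr
    have hsum := h.antitoneOn_sum (convex_Ici 0) Set.self_mem_Ici hr' hr'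
    have hbox := mem_Icc_of_sum_le (h r hr').1 (h r hr').2.1 hsum
    have h1 := sum_sub_three_le_spread (h r hr').1 (h r hr').2.1 hmpos hbox.1
    have h2 := h.sum_deriv_le hr'
    have h3 : ν ^ 2 / 6 * (12 / 7 * (s ^ 2)⁻¹ * (a r 0 + a r 1 + a r 2 - 3)) ≤
        ν ^ 2 / 6 * spread (a r) := mul_le_mul_of_nonneg_left h1 (by positivity)
    have h4 : flowFieldNormalized ν (a r) 0 + flowFieldNormalized ν (a r) 1 +
        flowFieldNormalized ν (a r) 2 + c * (a r 0 + a r 1 + a r 2 - 3) ≤ 0 := by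
      rw [hc]
      linarith
    calc _ = (flowFieldNormalized ν (a r) 0 + flowFieldNormalized ν (a r) 1 +
        flowFieldNormalized ν (a r) 2 + c * (a r 0 + a r 1 + a r 2 - 3)) * Real.exp (c * r) := by
          ring
      _ ≤ 0 := mul_nonpos_of_nonpos_of_nonneg h4 (Real.exp_pos _).le
  have hle := hanti Set.self_mem_Ici ht ht
  simp only [mul_zero, Real.exp_zero, mul_one] at hle
  rw [Real.exp_neg, ← div_eq_mul_inv, le_div_iff₀ (Real.exp_pos _)]
  exact hle

lemma IsSolution.tendsto {ν : ℝ} {a : ℝ → Fin 3 → ℝ} (hν : ν ≠ 0)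
    (h : IsSolution ν (Set.Ici 0) a) : Tendsto a atTop (𝓝 1) := by
  obtain ⟨c, hc, hle⟩ := h.sum_sub_three_le hν
  have hlim : Tendsto (fun t => (a 0 0 + a 0 1 + a 0 2 - 3) * Real.exp (-(c * t))) atTop
      (𝓝 0) := by
    have := (Real.tendsto_exp_neg_atTop_nhds_zero.comp (tendsto_id.const_mul_atTop hc)).const_mul
      (a 0 0 + a 0 1 + a 0 2 - 3)
    simpa using this
  have hsmall : ∀ᶠ t in atTop, (a 0 0 + a 0 1 + a 0 2 - 3) * Real.exp (-(c * t)) < 1 :=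
    hlim.eventually_lt_const one_pos
  rw [tendsto_pi_nhds]
  intro i
  have hsq : Tendsto (fun t => (a t i - 1) ^ 2) atTop (𝓝 0) := by
    have hup := hlim.const_mul 41
    rw [mul_zero] at hup
    refine squeeze_zero' (Eventually.of_forall fun t => sq_nonneg _) ?_ hup
    filter_upwards [hsmall, eventually_ge_atTop 0] with t ht ht0
    have hsol := h t ht0
    have := hle t ht0
    refine (sub_one_sq_le hsol.1 hsol.2.1 (by linarith) i).trans ?_
    linarith
  have habs := hsq.sqrt
  simp only [Real.sqrt_sq_eq_abs, Real.sqrt_zero] at habs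
  have := (tendsto_zero_iff_abs_tendsto_zero _).2 habs
  simpa using this.add_const 1

/-! ### Stability, existence, uniqueness and convergence in terms of metrics -/

lemma continuous_diagForm : Continuous diagForm := by
  refine continuous_matrix fun i j => ?_
  simp only [diagForm_eq, diagonal_apply]
  split_ifs
  exacts [continuous_apply _, continuous_const]

lemma trace_diagForm (a : Fin 3 → ℝ) : trace (diagForm a) = 2 * (a 0 + a 1 + a 2) := by
  rw [diagForm, trace_diagonal, Fin.sum_univ_six]
  simp only [cons_val]
  ring

/-- Along a volume-normalized flow the trace does not increase, and on the surface of volume one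
the sets of small trace form a basis of the neighbourhoods of the minimum. -/
lemma lyapunov_stable {ν V : ℝ} (hν : ν ≠ 0) (hV : 0 < V) {U : Set (Matrix (Fin 6) (Fin 6) ℝ)}
    (hU : U ∈ 𝓝 (diagForm 1)) : ∃ W ∈ 𝓝 (diagForm 1), ∀ g φ,
      IsFlowNormalized ν V (Set.Ici 0) g φ → g 0 ∈ W → ∀ t, 0 ≤ t → g t ∈ U := by
  obtain ⟨ε, hε, hball⟩ := Metric.mem_nhds_iff.1 (continuous_diagForm.continuousAt hU)
  set δ := min 1 (ε ^ 2 / 41) with hδ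
  have hδpos : 0 < δ := by positivity
  refine ⟨{h | trace h < 6 + 2 * δ}, ?_, fun g φ hflow h0 t ht => ?_⟩
  · refine (isOpen_lt (continuous_id.matrix_trace) continuous_const).mem_nhds ?_
    rw [Set.mem_ofPred_eq, id, trace_diagForm]
    simp only [Pi.one_apply]
    linarith
  · obtain ⟨a, φ₀, -, -, h⟩ := (isFlowNormalized_iff hν hV Set.ordConnected_Ici g φ).1 hflow
    have hsol : IsSolution ν (Set.Ici 0) a := fun s hs =>
      ⟨(h s hs).1, (h s hs).2.1, (h s hs).2.2.2.2⟩
    have hsum := hsol.antitoneOn_sum (convex_Ici 0) Set.self_mem_Ici ht ht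
    rw [Set.mem_ofPred_eq, (h 0 Set.self_mem_Ici).2.2.1, trace_diagForm] at h0
    have h3 : a t 0 + a t 1 + a t 2 < 3 + δ := by linarith
    have hδ1 : δ ≤ 1 := min_le_left _ _
    have hδε : δ ≤ ε ^ 2 / 41 := min_le_right _ _
    rw [(h t ht).2.2.1]
    refine hball ?_
    rw [Metric.mem_ball, dist_pi_lt_iff hε]
    intro i
    have hsq := sub_one_sq_le (h t ht).1 (h t ht).2.1 (by linarith) i
    rw [Real.dist_eq, Pi.one_apply]
    exact abs_lt_of_sq_lt_sq (by linarith) hε.le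

lemma exists_isFlowNormalized {ν V : ℝ} (hν : ν ≠ 0) (hV : 0 < V)
    {g₀ : Matrix (Fin 6) (Fin 6) ℝ} {φ₀ : Spinor} (h : (g₀, φ₀) ∈ unitSpinorsNormalized ν V) :
    ∃ g φ, IsFlowNormalized ν V (Set.Ici 0) g φ ∧ g 0 = g₀ ∧ φ 0 = φ₀ := by
  obtain ⟨hu, hvol⟩ := h
  obtain ⟨a₀, ha₀, rfl⟩ := (mem_invariantMetrics_iff hν g₀).1 hu.1
  obtain ⟨-, hφ, hn⟩ := (mem_unitSpinors_iff hν).1 hu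
  obtain ⟨a, h0, hsol⟩ := exists_solution_flowFieldNormalized ν ha₀
    ((volume_diagForm_eq_iff hV.ne' ha₀).1 hvol)
  refine ⟨fun t => diagForm (a t), fun _ => φ₀, ?_, congrArg diagForm h0, rfl⟩
  exact (isFlowNormalized_iff hν hV Set.ordConnected_Ici _ _).2 ⟨a, φ₀, hφ, hn, fun t ht =>
    ⟨(hsol t ht).1, (hsol t ht).2.1, rfl, rfl, (hsol t ht).2.2⟩⟩

lemma IsFlowNormalized.unique {ν V b : ℝ} (hν : ν ≠ 0) (hV : 0 < V)
    {g g' : ℝ → Matrix (Fin 6) (Fin 6) ℝ} {φ φ' : ℝ → Spinor}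
    (h : IsFlowNormalized ν V (Set.Ico 0 b) g φ) (h' : IsFlowNormalized ν V (Set.Ico 0 b) g' φ')
    (hg : g 0 = g' 0) (hφ : φ 0 = φ' 0) {t : ℝ} (ht : t ∈ Set.Ico 0 b) :
    g t = g' t ∧ φ t = φ' t := by
  obtain ⟨a, φ₀, -, -, ha⟩ := (isFlowNormalized_iff hν hV Set.ordConnected_Ico g φ).1 h
  obtain ⟨a', φ₀', -, -, ha'⟩ := (isFlowNormalized_iff hν hV Set.ordConnected_Ico g' φ').1 h'
  have h0 : (0 : ℝ) ∈ Set.Ico 0 b := ⟨le_rfl, ht.1.trans_lt ht.2⟩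
  have hsol : IsSolution ν (Set.Ico 0 b) a := fun s hs =>
    ⟨(ha s hs).1, (ha s hs).2.1, (ha s hs).2.2.2.2⟩
  have hsol' : IsSolution ν (Set.Ico 0 b) a' := fun s hs =>
    ⟨(ha' s hs).1, (ha' s hs).2.1, (ha' s hs).2.2.2.2⟩
  have haa : a 0 = a' 0 := diagForm_injective <| by
    rw [← (ha 0 h0).2.2.1, ← (ha' 0 h0).2.2.1, hg]
  constructor
  · rw [(ha t ht).2.2.1, (ha' t ht).2.2.1, hsol.eqOn hsol' haa ht]
  · rw [(ha t ht).2.2.2.1, (ha' t ht).2.2.2.1, ← (ha 0 h0).2.2.2.1, hφ, (ha' 0 h0).2.2.2.1]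

lemma IsFlowNormalized.tendsto {ν V : ℝ} (hν : ν ≠ 0) (hV : 0 < V)
    {g : ℝ → Matrix (Fin 6) (Fin 6) ℝ} {φ : ℝ → Spinor}
    (h : IsFlowNormalized ν V (Set.Ici 0) g φ) :
    (∀ t, 0 ≤ t → φ t = φ 0) ∧ Tendsto g atTop (𝓝 (diagForm 1)) := by
  obtain ⟨a, φ₀, -, -, ha⟩ := (isFlowNormalized_iff hν hV Set.ordConnected_Ici g φ).1 h
  refine ⟨fun t ht => ?_, ?_⟩
  · rw [(ha t ht).2.2.2.1, (ha 0 Set.self_mem_Ici).2.2.2.1]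
  · have hsol : IsSolution ν (Set.Ici 0) a := fun s hs =>
      ⟨(ha s hs).1, (ha s hs).2.1, (ha s hs).2.2.2.2⟩
    refine ((continuous_diagForm.tendsto 1).comp (hsol.tendsto hν)).congr' ?_
    filter_upwards [eventually_ge_atTop 0] with t ht
    exact (ha t ht).2.2.1.symm

end FlagSpinorFlow

end

open FlagSpinorFlow in
theorem mainTheorem7 (ν V : ℝ) (hν : 0 < ν) (hV : 0 < V) :
    -- invariant bilinear forms and invariant metrics
    (∀ h, h ∈ invariantForms ν ↔ ∃ v : Fin 3 → ℝ, h = diagForm v) ∧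
    (∀ g, g ∈ invariantMetrics ν ↔ ∃ a : Fin 3 → ℝ, (∀ i, 0 < a i) ∧ g = diagForm a) ∧
    -- invariant spinors
    (∀ g ∈ invariantMetrics ν,
      invariantSpinors ν g = Submodule.span ℂ {phi1, phi2} ∧
      Module.finrank ℂ (invariantSpinors ν g) = 2) ∧
    ‖phi1‖ = 1 ∧ ‖phi2‖ = 1 ∧
    -- the frames `g^{-1/2}` are horizontal for the Bourguignon-Gauduchon connection
    (∀ g ∈ invariantMetrics ν, ∀ k ∈ invariantForms ν, ∃ M : Matrix (Fin 6) (Fin 6) ℝ,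
      HasDerivAt (fun s : ℝ => frame (g + s • k)) M 0 ∧ ((frame g)⁻¹ * M).IsSymm) ∧
    -- volume and energy
    (∀ a : Fin 3 → ℝ, (∀ i, 0 < a i) → volume V (diagForm a) = V * (a 0 * a 1 * a 2)) ∧
    (∀ (a : Fin 3 → ℝ) (φ : Spinor), (diagForm a, φ) ∈ unitSpinors ν →
      energy ν V (diagForm a) φ = 4 * ν ^ 2 * V *
        (3 / 16 * (a 0 ^ 2 + a 1 ^ 2 + a 2 ^ 2)
          - 1 / 8 * (a 1 * a 2 + a 0 * a 1 + a 0 * a 2))) ∧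
    -- the negative gradients, and the two flows as explicit systems of ordinary equations
    (∀ (a : Fin 3 → ℝ) (φ : Spinor), (diagForm a, φ) ∈ unitSpinors ν → ∀ Q₁ Q₂,
      (IsNegGradient ν V (diagForm a) φ Q₁ Q₂ ↔ Q₁ = diagForm (flowField ν a) ∧ Q₂ = 0)) ∧
    (∀ (a : Fin 3 → ℝ) (φ : Spinor), (diagForm a, φ) ∈ unitSpinors ν → ∀ Q₁ Q₂,
      (IsNegGradientNormalized ν V (diagForm a) φ Q₁ Q₂ ↔
        Q₁ = diagForm (flowFieldNormalized ν a) ∧ Q₂ = 0)) ∧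
    (∀ (I : Set ℝ), I.OrdConnected → ∀ g φ, (IsFlow ν V I g φ ↔
      ∃ (a : ℝ → Fin 3 → ℝ) (φ₀ : Spinor),
        φ₀ ∈ Submodule.span ℂ {phi1, phi2} ∧ ‖φ₀‖ = 1 ∧
        ∀ t ∈ I, (∀ i, 0 < a t i) ∧ g t = diagForm (a t) ∧ φ t = φ₀ ∧
          HasDerivWithinAt a (flowField ν (a t)) I t)) ∧
    (∀ (I : Set ℝ), I.OrdConnected → ∀ g φ, (IsFlowNormalized ν V I g φ ↔
      ∃ (a : ℝ → Fin 3 → ℝ) (φ₀ : Spinor),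
        φ₀ ∈ Submodule.span ℂ {phi1, phi2} ∧ ‖φ₀‖ = 1 ∧
        ∀ t ∈ I, (∀ i, 0 < a t i) ∧ a t 0 * a t 1 * a t 2 = 1 ∧ g t = diagForm (a t) ∧
          φ t = φ₀ ∧ HasDerivWithinAt a (flowFieldNormalized ν (a t)) I t)) ∧
    -- critical points
    (∀ g φ, (g, φ) ∈ unitSpinors ν → ¬ IsNegGradient ν V g φ 0 0) ∧
    (∀ a φ, (diagForm a, φ) ∈ unitSpinorsNormalized ν V →
      (IsNegGradientNormalized ν V (diagForm a) φ 0 0 ↔ a 0 = a 1 ∧ a 1 = a 2)) ∧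
    (∀ a : Fin 3 → ℝ, (∃ φ, (diagForm a, φ) ∈ unitSpinorsNormalized ν V) →
      (a 0 = a 1 ∧ a 1 = a 2 ↔ a = 1)) ∧
    (∀ g φ ψ, (g, φ) ∈ unitSpinorsNormalized ν V → (diagForm 1, ψ) ∈ unitSpinorsNormalized ν V →
      energy ν V (diagForm 1) ψ ≤ energy ν V g φ) ∧
    -- the critical metric is strictly nearly Kähler and carries an invariant Killing spinor
    IsStrictlyNearlyKahler ν (diagForm 1) ∧
    (∃ (c : ℝ) (φ : Spinor), c ≠ 0 ∧ (diagForm 1, φ) ∈ unitSpinorsNormalized ν V ∧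
      IsKillingSpinor ν (diagForm 1) c φ) ∧
    -- linear stability
    HasFDerivAt (flowFieldNormalized ν)
      (LinearMap.toContinuousLinearMap (Matrix.toLin' (linearization ν))) 1 ∧
    (∀ μ : ℝ, Module.End.HasEigenvalue (Matrix.toLin' (linearization ν)) μ ↔
      μ = 0 ∨ μ = 4 * ν ^ 2 * (-(5 / 16))) ∧
    Module.End.maxGenEigenspace (Matrix.toLin' (linearization ν)) 0
      = Submodule.span ℝ {(1 : Fin 3 → ℝ)} ∧
    (∀ x : Fin 3 → ℝ, x 0 + x 1 + x 2 = 0 →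
      Matrix.toLin' (linearization ν) x = (4 * ν ^ 2 * (-(5 / 16))) • x) ∧
    (∀ U ∈ 𝓝 (diagForm 1), ∃ W ∈ 𝓝 (diagForm 1), ∀ g φ,
      IsFlowNormalized ν V (Set.Ici 0) g φ → g 0 ∈ W → ∀ t, 0 ≤ t → g t ∈ U) ∧
    -- global existence, uniqueness and convergence of the volume-normalized flow
    (∀ g₀ φ₀, (g₀, φ₀) ∈ unitSpinorsNormalized ν V →
      ∃ g φ, IsFlowNormalized ν V (Set.Ici 0) g φ ∧ g 0 = g₀ ∧ φ 0 = φ₀) ∧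
    (∀ (b : ℝ) (g g' : ℝ → Matrix (Fin 6) (Fin 6) ℝ) (φ φ' : ℝ → Spinor),
      IsFlowNormalized ν V (Set.Ico 0 b) g φ → IsFlowNormalized ν V (Set.Ico 0 b) g' φ' →
      g 0 = g' 0 → φ 0 = φ' 0 → ∀ t ∈ Set.Ico 0 b, g t = g' t ∧ φ t = φ' t) ∧
    (∀ g φ, IsFlowNormalized ν V (Set.Ici 0) g φ →
      (∀ t, 0 ≤ t → φ t = φ 0) ∧ Tendsto g atTop (𝓝 (diagForm 1))) := by
  have hν₀ : ν ≠ 0 := hν.ne'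
  refine ⟨mem_invariantForms_iff hν₀, mem_invariantMetrics_iff hν₀, fun g hg => ?_, norm_phi1,
    norm_phi2, fun g hg k hk => frame_horizontal hν₀ hg hk, fun a ha => volume_diagForm V ha,
    fun a φ h => ?_, fun a φ h => isNegGradient_iff hν₀ hV h,
    fun a φ h => isNegGradientNormalized_iff hν₀ hV h, fun I hI => isFlow_iff hν₀ hV hI,
    fun I hI => isFlowNormalized_iff hν₀ hV hI, fun g φ h => not_isNegGradient_zero hν₀ hV h,
    fun a φ h => ?_, fun a => ?_, fun g φ ψ h h1 => ?_, isStrictlyNearlyKahler_one hν₀,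
    exists_killingSpinor hν₀ hV, hasFDerivAt_flowFieldNormalized ν,
    hasEigenvalue_linearization_iff, maxGenEigenspace_linearization hν₀,
    fun x hx => linearization_apply_of_sum_eq_zero ν hx, fun U hU => lyapunov_stable hν₀ hV hU,
    fun g₀ φ₀ h => exists_isFlowNormalized hν₀ hV h,
    fun b g g' φ φ' h h' hg hφ t ht => h.unique hν₀ hV h' hg hφ ht,
    fun g φ h => h.tendsto hν₀ hV⟩
  · obtain ⟨a, ha, rfl⟩ := (mem_invariantMetrics_iff hν₀ g).1 hg
    rw [invariantSpinors_diagForm hν₀ ha]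
    exact ⟨rfl, finrank_span_phi⟩
  · rw [energy_diagForm V hν₀ ((mem_unitSpinors_iff hν₀).1 h).1 h.2.1, h.2.2, one_pow, mul_one,
      energyPoly]
  · have ha := ((mem_unitSpinors_iff hν₀).1 h.1).1
    have hzero : diagForm 0 = 0 := by
      rw [diagForm_eq]
      exact diagonal_zero
    rw [isNegGradientNormalized_iff hν₀ hV h.1, ← flowFieldNormalized_eq_zero_iff hν₀ ha, ← hzero,
      diagForm_injective.eq_iff, eq_comm]
    simp
  · rintro ⟨φ, h⟩
    have ha := ((mem_unitSpinors_iff hν₀).1 h.1).1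
    exact eq_one_iff_of_volume ha ((volume_diagForm_eq_iff hV.ne' ha).1 h.2)
  · obtain ⟨a, ha, rfl⟩ := (mem_invariantMetrics_iff hν₀ g).1 h.1.1
    have h1pos := ((mem_unitSpinors_iff hν₀).1 h1.1).1
    have e : energy ν V (diagForm 1) ψ = _ := energy_diagForm V hν₀ h1pos h1.1.2.1
    have e' : energy ν V (diagForm a) φ = _ := energy_diagForm V hν₀ ha h.1.2.1
    rw [e, e', (h1.1.2.2 : ‖ψ‖ = 1), (h.1.2.2 : ‖φ‖ = 1)]
    have := energyPoly_one_le ha ((volume_diagForm_eq_iff hV.ne' ha).1 h.2)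
    gcongr
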